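/- Let $p$ be a prime, $F\subset\overline{\mathbb{Q}}_p$ a finite extension of $\mathbb{Q}_p$ with ring of integers $\mathcal{O}_F$, let $n\ge 0$, let $I\subset\mathcal{O}_F[[X_1,\dots,X_n]]$ be an ideal and $A=\mathcal{O}_F[[X_1,\dots,X_n]]/I$, so that $\mathrm{Spf}(A)$ is a closed formal subscheme of $\widehat{\mathbb{G}}_m^n=\mathrm{Spf}(\mathcal{O}_F[[X_1,\dots,X_n]])$ with multiplicative coordinates $1+X_i$. The torsion points of $\widehat{\mathbb{G}}_m^n$ are the points $(\zeta_1-1,\dots,\zeta_n-1)$ with $\zeta_i\in\mu_{p^\infty}(\overline{\mathbb{Q}}_p)$; such a point lies on $\mathrm{Spf}(A)$ if every $f\in I$ vanishes at it, and the special points of $A$ are the corresponding prime ideals of $A$, each formed by the functions vanishing at a torsion point on $\mathrm{Spf}(A)$. A formal subtorus of dimension $d$ is $\widehat{\mathbb{G}}_m\otimes T\subset\widehat{\mathbb{G}}_m^n$ for a direct summand $T$ of rank $d$ of the cocharacter group $\mathbb{Z}_p^n$; its translate by a torsion point $(\zeta_i-1)_i$ with coordinates in $\mathcal{O}_K$,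 where $K$ is a finite extension of $F$, is the closed formal subscheme defined over $\mathcal{O}_K$ by the equations $\prod_i(1+X_i)^{a_i}=\prod_i\zeta_i^{a_i}$ for all $a\in\mathbb{Z}_p^n$ with $\sum_i a_it_i=0$ for every $t\in T$. (1) If $\mathrm{Spf}(A)$ contains infinitely many torsion points of $\widehat{\mathbb{G}}_m^n$, then there is a finite extension $K/F$ in $\overline{\mathbb{Q}}_p$ such that the base change of $\mathrm{Spf}(A)$ to $\mathcal{O}_K$ contains the translate of a formal subtorus of dimension $\ge 1$ by a torsion point with coordinates in $\mathcal{O}_K$. (2) Suppose that $\mathrm{Spf}(A)$ is geometrically irreducible, i.e. $\mathrm{Spec}(A\otimes_{\mathcal{O}_F}\mathcal{O}_K)$ is irreducible for every finite extension $K/F$, and that the special points are Zariski dense in $\mathrm{Spec}(A)$. Then the reduced closed formal subscheme $\mathrm{Spf}(A/\sqrt{0})$ is the translate of a formal subtorus, possibly of dimension $0$, by a torsion point with coordinates in $\mathcal{O}_F$. In particular, if $A$ is reduced, then $\mathrm{Spf}(A)$ itself is such a translate. -/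

import Mathlib

noncomputable section

namespace FormalTorus

/-- The ring of integers of a subfield `F` of the algebraic closure of `ℚ_p`: the elements of `F`
that are integral over `ℤ_p`. -/
def intRing {p : ℕ} [Fact p.Prime] (F : IntermediateField ℚ_[p] (PadicAlgCl p)) :
    Subalgebra ℤ_[p] (PadicAlgCl p) :=
  integralClosure ℤ_[p] (PadicAlgCl p) ⊓ F.toSubalgebra.restrictScalars ℤ_[p]

theorem intRing_mono {p : ℕ} [Fact p.Prime] {F K : IntermediateField ℚ_[p] (PadicAlgCl p)}
    (h : F ≤ K) : intRing F ≤ intRing K :=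
  fun _ hx => ⟨hx.1, h hx.2⟩

/-- `𝒪_F[[X_1, …, X_n]]`, the coordinate ring of the formal torus of dimension `n` over `𝒪_F`;
the multiplicative coordinates are `1 + X_i`. -/
abbrev TorusRing {p : ℕ} [Fact p.Prime] (n : ℕ) (F : IntermediateField ℚ_[p] (PadicAlgCl p)) :
    Type :=
  MvPowerSeries (Fin n) (intRing F)

/-- The inclusion `𝒪_F[[X_1, …, X_n]] → 𝒪_K[[X_1, …, X_n]]` for `F ⊆ K`. -/
def baseChange {p : ℕ} [Fact p.Prime] (n : ℕ) {F K : IntermediateField ℚ_[p] (PadicAlgCl p)}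
    (h : F ≤ K) : TorusRing n F →+* TorusRing n K :=
  MvPowerSeries.map (Subalgebra.inclusion (intRing_mono h)).toRingHom

/-- A tuple of `p`-power roots of unity: a torsion point of the formal torus in multiplicative
coordinates. Its coordinates `X_i` are the numbers `ζ i - 1`. -/
def IsTorsionPoint (p : ℕ) {n : ℕ} {R : Type*} [Monoid R] (ζ : Fin n → R) : Prop :=
  ∀ i, ∃ k : ℕ, ζ i ^ p ^ k = 1

/-- `f(ζ_1 - 1, …, ζ_n - 1) = 0`. For a torsion point `ζ` the series converges. -/
def VanishesAt {p : ℕ} [Fact p.Prime] {n : ℕ} {F : IntermediateField ℚ_[p] (PadicAlgCl p)}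
    (f : TorusRing n F) (ζ : Fin n → PadicAlgCl p) : Prop :=
  HasSum (fun m : Fin n →₀ ℕ =>
    ((MvPowerSeries.coeff m f : intRing F) : PadicAlgCl p) * ∏ i, (ζ i - 1) ^ m i) 0

/-- The torsion points over the algebraic closure of `ℚ_p` that lie on `Spf (𝒪_F[[X]] / I)`. -/
def torsionPointsOn {p : ℕ} [Fact p.Prime] {n : ℕ}
    {F : IntermediateField ℚ_[p] (PadicAlgCl p)} (I : Ideal (TorusRing n F)) :
    Set (Fin n → PadicAlgCl p) :=
  {ζ | IsTorsionPoint p ζ ∧ ∀ f ∈ I, VanishesAt f ζ}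

/-- The set of special points of `Spec A`, `A = 𝒪_F[[X]] / I`: the prime ideals of `A` that consist
of the functions vanishing at some torsion point. -/
def specialPoints {p : ℕ} [Fact p.Prime] {n : ℕ}
    {F : IntermediateField ℚ_[p] (PadicAlgCl p)} (I : Ideal (TorusRing n F)) :
    Set (PrimeSpectrum (TorusRing n F ⧸ I)) :=
  {P | ∃ ζ : Fin n → PadicAlgCl p, IsTorsionPoint p ζ ∧
    ∀ f : TorusRing n F, Ideal.Quotient.mk I f ∈ P.asIdeal ↔ VanishesAt f ζ}

/-- `Spf (𝒪_F[[X]] / I)` is geometrically irreducible: the spectrum of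
`(𝒪_F[[X]] / I) ⊗ 𝒪_K = 𝒪_K[[X]] / I 𝒪_K[[X]]` is irreducible (in particular nonempty) for every
finite extension `K` of `F`. -/
def GeometricallyIrreducible {p : ℕ} [Fact p.Prime] {n : ℕ}
    {F : IntermediateField ℚ_[p] (PadicAlgCl p)} (I : Ideal (TorusRing n F)) : Prop :=
  ∀ (K : IntermediateField ℚ_[p] (PadicAlgCl p)) (h : F ≤ K), FiniteDimensional ℚ_[p] K →
    IrreducibleSpace (PrimeSpectrum (TorusRing n K ⧸ I.map (baseChange n h)))

/-- The character `∏ i, (1 + X_i) ^ a_i` of the formal torus, for `a ∈ ℤ_p^n`. By the binomial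
series `(1 + X) ^ c = ∑ k, (c choose k) X ^ k`, its coefficient at `X ^ m` is
`∏ i, (a_i choose m_i)`. -/
def character {p : ℕ} [Fact p.Prime] {n : ℕ} (F : IntermediateField ℚ_[p] (PadicAlgCl p))
    (a : Fin n → ℤ_[p]) : TorusRing n F :=
  fun m => algebraMap ℤ_[p] (intRing F) (∏ i, Ring.choose (a i) (m i))

/-- The power `z ^ a` of a `p`-power root of unity `z` with exponent `a ∈ ℤ_p`: if `z` has order
`p ^ k`, it is `z ^ b` for any natural number `b ≡ a` modulo `p ^ k`. -/
def rootPow {p : ℕ} [Fact p.Prime] {R : Type*} [Monoid R] (z : R) (a : ℤ_[p]) : R :=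
  z ^ a.appr (padicValNat p (orderOf z))

/-- Formal subtori of the formal torus of dimension `n` correspond to the direct summands `T` of its
cocharacter group `ℤ_p^n`, via `T ↦ 𝔾_m ⊗ T`. The rank of `T` is the dimension of the subtorus. -/
def IsSubtorus {p : ℕ} [Fact p.Prime] {n : ℕ} (T : Submodule ℤ_[p] (Fin n → ℤ_[p])) : Prop :=
  ∃ T' : Submodule ℤ_[p] (Fin n → ℤ_[p]), IsCompl T T'

/-- The ideal of the translate by the torsion point `ζ` of the formal subtorus `𝔾_m ⊗ T`. The
subtorus is cut out by the equations `χ = 1`, where `χ` runs through the characters that are trivial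
on `T`, and its translate by `ζ` by the equations `χ = χ(ζ)`. -/
def translateIdeal {p : ℕ} [Fact p.Prime] {n : ℕ} (F : IntermediateField ℚ_[p] (PadicAlgCl p))
    (T : Submodule ℤ_[p] (Fin n → ℤ_[p])) (ζ : Fin n → intRing F) : Ideal (TorusRing n F) :=
  Ideal.span {g | ∃ a : Fin n → ℤ_[p], (∀ t ∈ T, ∑ i, a i * t i = 0) ∧
    g = character F a - MvPowerSeries.C (∏ i, rootPow (ζ i) (a i))}

end FormalTorus

end

noncomputable section

namespace FormalTorus

open MvPowerSeries.WithPiTopology Filter Topology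

variable {p : ℕ} [Fact p.Prime]

/-! A single statement about ultrafilters gives both assertions. Let `U` be an ultrafilter on the
torsion points lying on the subscheme. The characters whose values have bounded order along `U` form
a saturated subgroup `P` of `ℤ_p^n`, and on `P` the values are `U`-almost everywhere equal to those
of one fixed point. Then the power series vanishing `U`-almost everywhere form exactly the ideal of
a translate of the subtorus orthogonal to `P` (`eventually_evalAt_eq_zero_iff`).

Dividing out `P` reduces this to the generic case, where no nontrivial character is trivial along
`U`: a nonzero power series then cannot vanish along `U` (`eq_zero_of_eventually_evalAt_eq_zero`).
For the proof, a Gaussian elimination driven by the orders of roots of unity (`exists_basis_closer`)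
finds coordinates whose distances to `1` tend to `1` at incomparable rates: each earlier distance is
below every power of each later one. The lexicographically first coefficient of maximal norm then
gives a strictly dominant term, because the value group is discrete while monomials in the
coordinates have norm tending to `1`.

For (1), take `U` nonprincipal; `P` cannot be everything, or `U` would concentrate on one point. For
(2), irreducibility and density provide a `U` whose vanishing ideal is the radical of `I`. Geometric
irreducibility makes every character in `P` constant on all torsion points of the subscheme, so
Galois invariance puts its value in `F`, and a projection onto `P` turns these values into a torsion
point over `𝒪_F`. -/

/-! ### Rings of integers: norms, topology and compactness -/

/-- The norm is the spectral norm, which is at most `1` exactly when the minimal polynomial has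
coefficients in `ℤ_p`. -/
theorem isIntegral_iff_norm_le_one (x : PadicAlgCl p) : IsIntegral ℤ_[p] x ↔ ‖x‖ ≤ 1 := by
  have hmonic : (minpoly ℚ_[p] x).Monic :=
    minpoly.monic (Algebra.IsIntegral.isIntegral x)
  rw [← PadicAlgCl.spectralNorm_eq, spectralNorm, spectralValue_le_one_iff hmonic]
  constructor
  · intro hx n
    rw [minpoly.isIntegrallyClosed_eq_field_fractions' ℚ_[p] hx, Polynomial.coeff_map]
    exact PadicInt.norm_le_one _
  · intro h
    have hl : minpoly ℚ_[p] x ∈ Polynomial.lifts (algebraMap ℤ_[p] ℚ_[p]) :=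
      (Polynomial.lifts_iff_coeff_lifts _).2 fun n => ⟨⟨_, h n⟩, rfl⟩
    obtain ⟨q, hq, -, hqm⟩ := Polynomial.lifts_and_natDegree_eq_and_monic hl hmonic
    refine ⟨q, hqm, ?_⟩
    have := minpoly.aeval ℚ_[p] x
    rwa [← hq, Polynomial.aeval_map_algebraMap] at this

theorem mem_intRing_iff {K : IntermediateField ℚ_[p] (PadicAlgCl p)} {x : PadicAlgCl p} :
    x ∈ intRing K ↔ ‖x‖ ≤ 1 ∧ x ∈ K := by
  rw [← isIntegral_iff_norm_le_one]
  exact Iff.rfl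

theorem norm_intRing_le_one {K : IntermediateField ℚ_[p] (PadicAlgCl p)} (x : intRing K) :
    ‖(x : PadicAlgCl p)‖ ≤ 1 :=
  (mem_intRing_iff.1 x.2).1

section IntRing

variable (K : IntermediateField ℚ_[p] (PadicAlgCl p))

/-- Open balls around `0` are ideals by the ultrametric inequality. Substitution into power series
requires a linear topology. -/
instance isLinearTopology_intRing : IsLinearTopology (intRing K) (intRing K) := by
  let s : {ε : ℝ // 0 < ε} → Ideal (intRing K) := fun ε =>
    { carrier := {x | ‖x‖ < ε}
      add_mem' := fun {a b} ha hb =>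
        lt_of_le_of_lt (IsUltrametricDist.norm_add_le_max a b) (max_lt ha hb)
      zero_mem' := by simpa using ε.2
      smul_mem' := fun c x hx => by
        change ‖x‖ < ε at hx
        change ‖c * x‖ < ε
        refine lt_of_le_of_lt ?_ hx
        refine (norm_mul_le c x).trans ?_
        exact mul_le_of_le_one_left (norm_nonneg _) (norm_intRing_le_one c) }
  refine IsLinearTopology.mk_of_hasBasis (ι := {ε : ℝ // 0 < ε}) (p := fun _ => True) (s := s) _ ?_
  refine ⟨fun t => ?_⟩
  rw [Metric.nhds_basis_ball.mem_iff]
  constructor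
  · rintro ⟨ε, hε, h⟩
    refine ⟨⟨ε, hε⟩, trivial, fun x hx => h ?_⟩
    change ‖x‖ < ε at hx
    simpa using hx
  · rintro ⟨⟨ε, hε⟩, -, h⟩
    refine ⟨ε, hε, fun x hx => h ?_⟩
    change ‖x‖ < ε
    simpa using hx

instance compactSpace_intRing [FiniteDimensional ℚ_[p] K] : CompactSpace (intRing K) := by
  have : ProperSpace K := FiniteDimensional.proper ℚ_[p] K
  have hc : IsCompact (Subtype.val '' (Metric.closedBall (0 : K) 1)) :=
    (isCompact_closedBall (0 : K) 1).image continuous_subtype_val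
  have he : Subtype.val '' (Metric.closedBall (0 : K) 1) = (intRing K : Set (PadicAlgCl p)) := by
    ext x
    rw [SetLike.mem_coe, mem_intRing_iff]
    constructor
    · rintro ⟨y, hy, rfl⟩
      exact ⟨by simpa using hy, y.2⟩
    · rintro ⟨h1, h2⟩
      exact ⟨⟨x, h2⟩, by simpa using h1, rfl⟩
  rw [he] at hc
  exact isCompact_iff_compactSpace.1 hc

instance compactSpace_torusRing [FiniteDimensional ℚ_[p] K] (n : ℕ) :
    CompactSpace (TorusRing n K) :=
  inferInstanceAs (CompactSpace ((Fin n →₀ ℕ) → intRing K))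

/-- Norms `< 1` in a finite extension of `ℚ_p` are bounded away from `1`. -/
theorem exists_norm_gap [FiniteDimensional ℚ_[p] K] :
    ∃ r : ℝ, 0 < r ∧ r < 1 ∧ ∀ x ∈ K, ‖x‖ < 1 → ‖x‖ ≤ r := by
  have : ProperSpace K := FiniteDimensional.proper ℚ_[p] K
  have hc : IsCompact (Metric.ball (0 : K) 1) := by
    refine (isCompact_closedBall (0 : K) 1).of_isClosed_subset ?_ Metric.ball_subset_closedBall
    exact IsUltrametricDist.isClosed_ball _ _
  obtain ⟨y, hy, hmax⟩ := hc.exists_isMaxOn ⟨0, by simp⟩ continuous_norm.continuousOn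
  have hy1 : ‖y‖ < 1 := by simpa using hy
  refine ⟨max ‖y‖ (1 / 2), by positivity, max_lt hy1 (by norm_num), fun x hx hx1 => ?_⟩
  exact le_max_of_le_left (hmax (a := ⟨x, hx⟩) (by simpa using hx1))

end IntRing

theorem continuous_coe_algebraMap_int :
    Continuous (algebraMap ℤ_[p] (PadicAlgCl p)) := by
  have : (algebraMap ℤ_[p] (PadicAlgCl p) : ℤ_[p] → PadicAlgCl p) =
      algebraMap ℚ_[p] (PadicAlgCl p) ∘ ((↑) : ℤ_[p] → ℚ_[p]) := by
    ext x; exact IsScalarTower.algebraMap_apply ℤ_[p] ℚ_[p] (PadicAlgCl p) x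
  rw [this]
  exact (algebraMapCLM ℚ_[p] (PadicAlgCl p)).continuous.comp continuous_subtype_val

theorem continuous_algebraMap_intRing (K : IntermediateField ℚ_[p] (PadicAlgCl p)) :
    Continuous (algebraMap ℤ_[p] (intRing K)) :=
  Continuous.subtype_mk continuous_coe_algebraMap_int _

theorem continuous_inclusion_intRing {F K : IntermediateField ℚ_[p] (PadicAlgCl p)} (h : F ≤ K) :
    Continuous (Subalgebra.inclusion (intRing_mono h)).toRingHom :=
  Continuous.subtype_mk continuous_subtype_val _

/-- Two continuous ring homomorphisms on a power series ring agree if they agree on constants and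
variables. -/
theorem ringHom_eq_of_continuous {σ R S : Type*} [CommRing R] [TopologicalSpace R]
    [CommRing S] [TopologicalSpace S] [T2Space S] {φ ψ : MvPowerSeries σ R →+* S}
    (hφ : Continuous φ) (hψ : Continuous ψ)
    (hC : ∀ c, φ (MvPowerSeries.C c) = ψ (MvPowerSeries.C c))
    (hX : ∀ i, φ (MvPowerSeries.X i) = ψ (MvPowerSeries.X i)) : φ = ψ := by
  have h : φ.comp MvPolynomial.coeToMvPowerSeries.ringHom =
      ψ.comp MvPolynomial.coeToMvPowerSeries.ringHom :=
    MvPolynomial.ringHom_ext (fun c => by simpa using hC c) (fun i => by simpa using hX i)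
  refine DFunLike.coe_injective ?_
  refine DenseRange.equalizer (denseRange_toMvPowerSeries (σ := σ) (R := R)) hφ hψ ?_
  ext q
  simpa using RingHom.congr_fun h q

/-! ### Powers of `p`-power roots of unity with exponents in `ℤ_p` -/

section RootPow

variable {M : Type*} [Monoid M]

/-- The exponent matters only modulo the order of `z`, which divides `p ^ k`. With a common `k`,
identities for `p`-adic exponents reduce to natural ones. -/
theorem rootPow_eq_pow {z : M} {k : ℕ} (hz : z ^ p ^ k = 1) {a : ℤ_[p]} {b : ℕ}
    (hab : a - b ∈ Ideal.span {(p : ℤ_[p]) ^ k}) : rootPow z a = z ^ b := by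
  obtain ⟨j, hjk, hj⟩ := (Nat.dvd_prime_pow Fact.out).1 (orderOf_dvd_of_pow_eq_one hz)
  rw [rootPow, hj, padicValNat.prime_pow]
  refine pow_eq_pow_of_modEq (n := p ^ j) ?_ (by rw [← hj, pow_orderOf_eq_one])
  rw [← Int.natCast_modEq_iff, Int.modEq_comm, Int.modEq_iff_dvd]
  rw [Ideal.mem_span_singleton] at hab
  have h1 : (p : ℤ_[p]) ^ j ∣ a - a.appr j := Ideal.mem_span_singleton.1 (PadicInt.appr_spec j a)
  have h2 : (p : ℤ_[p]) ^ j ∣ a - b := (pow_dvd_pow _ hjk).trans hab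
  have h3 : (p : ℤ_[p]) ^ j ∣ ((a.appr j - b : ℤ) : ℤ_[p]) := by
    have := dvd_sub h2 h1
    push_cast
    convert! this using 1
    ring
  exact_mod_cast (PadicInt.pow_p_dvd_int_iff j _).1 h3

theorem exists_nat_sub_mem (k : ℕ) (a : ℤ_[p]) :
    ∃ b : ℕ, a - b ∈ Ideal.span {(p : ℤ_[p]) ^ k} :=
  ⟨a.appr k, PadicInt.appr_spec k a⟩

variable {z : M} {k : ℕ}

theorem rootPow_natCast (hz : z ^ p ^ k = 1) (b : ℕ) : rootPow z (b : ℤ_[p]) = z ^ b :=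
  rootPow_eq_pow hz (by simp)

theorem rootPow_add (hz : z ^ p ^ k = 1) (a b : ℤ_[p]) :
    rootPow z (a + b) = rootPow z a * rootPow z b := by
  obtain ⟨a', ha⟩ := exists_nat_sub_mem k a
  obtain ⟨b', hb⟩ := exists_nat_sub_mem k b
  rw [rootPow_eq_pow hz ha, rootPow_eq_pow hz hb, ← pow_add]
  refine rootPow_eq_pow hz ?_
  convert! Ideal.add_mem _ ha hb using 1
  push_cast
  ring

theorem rootPow_pow_eq_one (hz : z ^ p ^ k = 1) (a : ℤ_[p]) : rootPow z a ^ p ^ k = 1 := by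
  rw [rootPow, ← pow_mul, mul_comm, pow_mul, hz, one_pow]

theorem rootPow_mul (hz : z ^ p ^ k = 1) (a b : ℤ_[p]) :
    rootPow z (b * a) = rootPow (rootPow z a) b := by
  obtain ⟨a', ha⟩ := exists_nat_sub_mem k a
  obtain ⟨b', hb⟩ := exists_nat_sub_mem k b
  rw [rootPow_eq_pow (rootPow_pow_eq_one hz a) hb, rootPow_eq_pow hz ha, ← pow_mul]
  refine rootPow_eq_pow hz ?_
  convert! Ideal.add_mem _ (Ideal.mul_mem_left _ b ha) (Ideal.mul_mem_left _ (a' : ℤ_[p]) hb) using 1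
  push_cast
  ring

theorem map_rootPow {N : Type*} [Monoid N] (f : M →* N) (hz : z ^ p ^ k = 1) (a : ℤ_[p]) :
    f (rootPow z a) = rootPow (f z) a := by
  obtain ⟨a', ha⟩ := exists_nat_sub_mem k a
  rw [rootPow_eq_pow hz ha, rootPow_eq_pow (z := f z) (by rw [← map_pow, hz, map_one]) ha, map_pow]

theorem continuous_rootPow [TopologicalSpace M] (hz : z ^ p ^ k = 1) :
    Continuous (fun a : ℤ_[p] => rootPow z a) := by
  refine IsLocallyConstant.continuous ((IsLocallyConstant.iff_eventually_eq _).2 fun a => ?_)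
  have hball : Metric.ball a ((p : ℝ) ^ (-(k : ℤ))) ∈ 𝓝 a :=
    Metric.ball_mem_nhds _ (zpow_pos (by exact_mod_cast (Fact.out : p.Prime).pos) _)
  filter_upwards [hball] with b hb
  obtain ⟨a', ha⟩ := exists_nat_sub_mem k a
  rw [rootPow_eq_pow hz ha]
  refine rootPow_eq_pow hz ?_
  rw [Metric.mem_ball, dist_eq_norm] at hb
  have := (PadicInt.norm_le_pow_iff_mem_span_pow _ k).1 hb.le
  convert! Ideal.add_mem _ this ha using 1
  ring

end RootPow

/-- A closed additive submonoid of `ℤ_p^n` that contains the standard basis is everything. -/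
theorem mem_of_isClosed {n : ℕ} {S : Set (Fin n → ℤ_[p])} (hS : IsClosed S) (h0 : 0 ∈ S)
    (hadd : ∀ a ∈ S, ∀ b ∈ S, a + b ∈ S) (h : ∀ i, Pi.single i 1 ∈ S) (a : Fin n → ℤ_[p]) :
    a ∈ S := by
  have hs : ∀ (i : Fin n) (c : ℤ_[p]), Pi.single i c ∈ S := by
    intro i c
    refine (PadicInt.denseRange_natCast (p := p)).induction_on c
      (hS.preimage (continuous_single (A := fun _ : Fin n => ℤ_[p]) i)) fun m => ?_
    induction m with
    | zero => simpa using h0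
    | succ m ih =>
      rw [Nat.cast_succ, Pi.single_add]
      exact hadd _ ih _ (h i)
  rw [← Finset.univ_sum_single a]
  exact Finset.sum_induction _ (· ∈ S) (fun a b ha hb => hadd a ha b hb) h0 fun i _ => hs i _

/-- A continuous homomorphism from `ℤ_p^n` is determined by the images of the standard basis. -/
theorem eq_of_continuous_of_single {n : ℕ} {M : Type*} [CommMonoid M] [TopologicalSpace M]
    [T2Space M] {f g : (Fin n → ℤ_[p]) → M} (hf : Continuous f) (hg : Continuous g)
    (hf0 : f 0 = 1) (hg0 : g 0 = 1) (hfa : ∀ a b, f (a + b) = f a * f b)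
    (hga : ∀ a b, g (a + b) = g a * g b)
    (h : ∀ i, f (Pi.single i 1) = g (Pi.single i 1)) : f = g :=
  funext fun a => mem_of_isClosed (S := {a | f a = g a}) (isClosed_eq hf hg)
    (hf0.trans hg0.symm)
    (fun a ha b hb => by rw [Set.mem_ofPred_eq] at *; rw [hfa, hga, ha, hb]) h a

/-! ### Values of characters at torsion points -/

section TorsPow

variable {n : ℕ} {M : Type*} [CommMonoid M]

/-- The value `∏ i, ζ_i ^ a_i` of the character with exponents `a` at the torsion point `ζ`. -/
def torsPow (ζ : Fin n → M) (a : Fin n → ℤ_[p]) : M := ∏ i, rootPow (ζ i) (a i)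

omit [Fact p.Prime] in
theorem IsTorsionPoint.exists_pow {ζ : Fin n → M} (hζ : IsTorsionPoint p ζ) :
    ∃ k : ℕ, ∀ i, ζ i ^ p ^ k = 1 := by
  choose k hk using hζ
  refine ⟨Finset.univ.sup k, fun i => ?_⟩
  obtain ⟨c, hc⟩ := pow_dvd_pow p (Finset.le_sup (f := k) (Finset.mem_univ i))
  rw [hc, pow_mul, hk, one_pow]

variable {ζ : Fin n → M}

theorem torsPow_pow_eq_one {k : ℕ} (hk : ∀ i, ζ i ^ p ^ k = 1) (a : Fin n → ℤ_[p]) :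
    torsPow ζ a ^ p ^ k = 1 := by
  rw [torsPow, ← Finset.prod_pow]
  exact Finset.prod_eq_one fun i _ => rootPow_pow_eq_one (hk i) _

theorem torsPow_zero (hζ : IsTorsionPoint p ζ) : torsPow ζ (0 : Fin n → ℤ_[p]) = 1 := by
  refine Finset.prod_eq_one fun i _ => ?_
  obtain ⟨k, hk⟩ := hζ i
  simpa using rootPow_natCast hk 0

theorem torsPow_add (hζ : IsTorsionPoint p ζ) (a b : Fin n → ℤ_[p]) :
    torsPow ζ (a + b) = torsPow ζ a * torsPow ζ b := by
  rw [torsPow, torsPow, torsPow, ← Finset.prod_mul_distrib]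
  refine Finset.prod_congr rfl fun i _ => ?_
  obtain ⟨k, hk⟩ := hζ i
  exact rootPow_add hk _ _

theorem torsPow_neg_mul (hζ : IsTorsionPoint p ζ) (a : Fin n → ℤ_[p]) :
    torsPow ζ (-a) * torsPow ζ a = 1 := by
  rw [← torsPow_add hζ, neg_add_cancel, torsPow_zero hζ]

theorem torsPow_single (hζ : IsTorsionPoint p ζ) (i : Fin n) :
    torsPow ζ (Pi.single i (1 : ℤ_[p])) = ζ i := by
  rw [torsPow, Finset.prod_eq_single i]
  · obtain ⟨k, hk⟩ := hζ i
    simpa using rootPow_natCast hk 1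
  · intro j _ hj
    obtain ⟨k, hk⟩ := hζ j
    simpa [hj] using rootPow_natCast hk 0
  · simp

theorem rootPow_prod {ι : Type*} (s : Finset ι) {w : ι → M} {k : ℕ}
    (hw : ∀ i ∈ s, w i ^ p ^ k = 1) (c : ℤ_[p]) :
    rootPow (∏ i ∈ s, w i) c = ∏ i ∈ s, rootPow (w i) c := by
  obtain ⟨c', hc⟩ := exists_nat_sub_mem k c
  rw [rootPow_eq_pow (by rw [← Finset.prod_pow]; exact Finset.prod_eq_one hw) hc,
    ← Finset.prod_pow]
  exact Finset.prod_congr rfl fun i hi => (rootPow_eq_pow (hw i hi) hc).symm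

theorem torsPow_smul (hζ : IsTorsionPoint p ζ) (c : ℤ_[p]) (a : Fin n → ℤ_[p]) :
    torsPow ζ (c • a) = rootPow (torsPow ζ a) c := by
  obtain ⟨k, hk⟩ := hζ.exists_pow
  rw [torsPow, torsPow, rootPow_prod _ (fun i _ => rootPow_pow_eq_one (hk i) _)]
  exact Finset.prod_congr rfl fun i _ => rootPow_mul (hk i) _ _

theorem torsPow_natCast_smul (hζ : IsTorsionPoint p ζ) (c : ℕ) (a : Fin n → ℤ_[p]) :
    torsPow ζ ((c : ℤ_[p]) • a) = torsPow ζ a ^ c := by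
  obtain ⟨k, hk⟩ := hζ.exists_pow
  rw [torsPow_smul hζ, rootPow_natCast (torsPow_pow_eq_one hk a)]

theorem continuous_torsPow [TopologicalSpace M] [ContinuousMul M] (hζ : IsTorsionPoint p ζ) :
    Continuous (fun a : Fin n → ℤ_[p] => torsPow ζ a) := by
  refine continuous_finsetProd _ fun i _ => ?_
  obtain ⟨k, hk⟩ := hζ i
  exact (continuous_rootPow hk).comp (continuous_apply i)

theorem map_torsPow {N : Type*} [CommMonoid N] (f : M →* N) (hζ : IsTorsionPoint p ζ)
    (a : Fin n → ℤ_[p]) : f (torsPow ζ a) = torsPow (fun i => f (ζ i)) a := by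
  rw [torsPow, map_prod]
  refine Finset.prod_congr rfl fun i _ => ?_
  obtain ⟨k, hk⟩ := hζ i
  exact map_rootPow f hk _

omit [Fact p.Prime] in
theorem IsTorsionPoint.map {N : Type*} [Monoid N] (f : M →* N) (hζ : IsTorsionPoint p ζ) :
    IsTorsionPoint p (fun i => f (ζ i)) := by
  intro i
  obtain ⟨k, hk⟩ := hζ i
  exact ⟨k, by rw [← map_pow, hk, map_one]⟩

theorem IsTorsionPoint.torsPow {d : ℕ} (hζ : IsTorsionPoint p ζ) (a : Fin d → Fin n → ℤ_[p]) :
    IsTorsionPoint p (fun i => torsPow ζ (a i)) := by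
  obtain ⟨k, hk⟩ := hζ.exists_pow
  exact fun i => ⟨k, torsPow_pow_eq_one hk _⟩

omit [Fact p.Prime] in
theorem IsTorsionPoint.mul {ξ : Fin n → M} (hζ : IsTorsionPoint p ζ) (hξ : IsTorsionPoint p ξ) :
    IsTorsionPoint p (fun i => ζ i * ξ i) := by
  obtain ⟨k, hk⟩ := hζ.exists_pow
  obtain ⟨l, hl⟩ := hξ.exists_pow
  refine fun i => ⟨k + l, ?_⟩
  rw [mul_pow, pow_add, pow_mul, hk, mul_comm (p ^ k), pow_mul, hl]
  simp

theorem torsPow_mul {ξ : Fin n → M} (hζ : IsTorsionPoint p ζ) (hξ : IsTorsionPoint p ξ)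
    (a : Fin n → ℤ_[p]) :
    torsPow (fun i => ζ i * ξ i) a = torsPow ζ a * torsPow ξ a := by
  -- Exponentiation is locally constant in the exponent, so the density argument already works for
  -- the discrete topology.
  let _ : TopologicalSpace M := ⊥
  have : DiscreteTopology M := ⟨rfl⟩
  refine congr_fun (eq_of_continuous_of_single (continuous_torsPow (hζ.mul hξ))
    (g := fun a => torsPow ζ a * torsPow ξ a) ((continuous_torsPow hζ).mul (continuous_torsPow hξ)) ?_ ?_ ?_ ?_ ?_) a
  · exact torsPow_zero (hζ.mul hξ)
  · simp only [torsPow_zero hζ, torsPow_zero hξ, one_mul]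
  · exact torsPow_add (hζ.mul hξ)
  · intro a b
    simp only [torsPow_add hζ, torsPow_add hξ, mul_mul_mul_comm]
  · intro i
    simp only [torsPow_single (hζ.mul hξ), torsPow_single hζ, torsPow_single hξ]

theorem continuous_linearMap {m d : ℕ} (L : (Fin m → ℤ_[p]) →ₗ[ℤ_[p]] (Fin d → ℤ_[p])) :
    Continuous L :=
  LinearMap.continuous_on_pi L

/-- Pulling back a torsion point along a linear map of character groups. -/
theorem torsPow_linearMap {m : ℕ} (hζ : IsTorsionPoint p ζ)
    (L : (Fin m → ℤ_[p]) →ₗ[ℤ_[p]] (Fin n → ℤ_[p])) (a : Fin m → ℤ_[p]) :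
    torsPow (fun i => torsPow ζ (L (Pi.single i 1))) a = torsPow ζ (L a) := by
  let _ : TopologicalSpace M := ⊥
  have : DiscreteTopology M := ⟨rfl⟩
  have h := hζ.torsPow fun i => L (Pi.single i 1)
  refine congr_fun (eq_of_continuous_of_single (continuous_torsPow h)
    ((continuous_torsPow hζ).comp (continuous_linearMap L)) ?_ ?_ ?_ ?_ ?_) a
  · exact torsPow_zero h
  · simp [torsPow_zero hζ]
  · exact torsPow_add h
  · intro a b
    simp [torsPow_add hζ]
  · intro i
    simp [torsPow_single h]

end TorsPow

/-! ### Distances of `p`-power roots of unity from `1` -/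

section Norm

theorem norm_natCast_prime_pos : 0 < ‖(p : PadicAlgCl p)‖ :=
  norm_pos_iff.2 (by exact_mod_cast (Fact.out : p.Prime).ne_zero)

theorem norm_natCast_prime_lt_one : ‖(p : PadicAlgCl p)‖ < 1 := by
  rw [← map_natCast (algebraMap ℚ_[p] (PadicAlgCl p)), PadicAlgCl.norm_extends]
  exact Padic.norm_p_lt_one

theorem norm_pow_sub_one_le {z : PadicAlgCl p} (hz : ‖z‖ ≤ 1) (m : ℕ) :
    ‖z ^ m - 1‖ ≤ ‖z - 1‖ := by
  rw [← mul_geom_sum, norm_mul]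
  refine mul_le_of_le_one_right (norm_nonneg _) ?_
  refine IsUltrametricDist.norm_sum_le_of_forall_le_of_nonneg zero_le_one fun i _ => ?_
  rw [norm_pow]
  exact pow_le_one₀ (norm_nonneg _) hz

theorem norm_sub_one_le_one {z : PadicAlgCl p} (hz : ‖z‖ ≤ 1) : ‖z - 1‖ ≤ 1 :=
  by
  rw [sub_eq_add_neg]
  refine (IsUltrametricDist.norm_add_le_max z (-1)).trans (max_le hz ?_)
  rw [norm_neg, norm_one]

theorem norm_pow_prime_sub_one_sub_le {z : PadicAlgCl p} (hz : ‖z‖ ≤ 1) :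
    ‖z ^ p - 1 - (z - 1) ^ p‖ ≤ ‖(p : PadicAlgCl p)‖ * ‖z - 1‖ := by
  have h := add_pow_prime_eq (Fact.out : p.Prime) (z - 1) 1
  rw [sub_add_cancel, one_pow] at h
  have h2 : z ^ p - 1 - (z - 1) ^ p = p * (z - 1) *
      ∑ k ∈ Finset.Ioo 0 p, (z - 1) ^ (k - 1) * 1 ^ (p - k - 1) * ((p.choose k / p : ℕ)) := by
    rw [h]; ring
  rw [h2, norm_mul, norm_mul]
  refine mul_le_of_le_one_right (by positivity) ?_
  refine IsUltrametricDist.norm_sum_le_of_forall_le_of_nonneg zero_le_one fun i _ => ?_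
  rw [one_pow, mul_one, norm_mul, norm_pow]
  refine mul_le_one₀ (pow_le_one₀ (norm_nonneg _) (norm_sub_one_le_one hz)) (norm_nonneg _) ?_
  exact IsUltrametricDist.norm_natCast_le_one _ _

theorem norm_pow_prime_sub_one_le {z : PadicAlgCl p} (hz : ‖z‖ ≤ 1) :
    ‖z ^ p - 1‖ ≤ max (‖z - 1‖ ^ p) (‖(p : PadicAlgCl p)‖ * ‖z - 1‖) := by
  have h : z ^ p - 1 = (z - 1) ^ p + (z ^ p - 1 - (z - 1) ^ p) := by ring
  rw [h, ← norm_pow]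
  exact (IsUltrametricDist.norm_add_le_max _ _).trans
    (max_le_max le_rfl (norm_pow_prime_sub_one_sub_le hz))

variable {z : PadicAlgCl p} {k : ℕ}

theorem norm_eq_one_of_pow_eq_one (hz : z ^ p ^ k = 1) : ‖z‖ = 1 := by
  have h : ‖z‖ ^ p ^ k = 1 := by rw [← norm_pow, hz, norm_one]
  exact (pow_eq_one_iff_of_nonneg (norm_nonneg _)
    (pow_ne_zero _ (Fact.out : p.Prime).ne_zero)).1 h

/-- Modulo `p`, raising to the `p`-th power commutes with subtracting `1`; so distance `1` would
persist under `p`-th powers until the root of unity becomes `1`. -/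
theorem norm_sub_one_lt_one (hz : z ^ p ^ k = 1) : ‖z - 1‖ < 1 := by
  refine lt_of_le_of_ne (norm_sub_one_le_one (norm_eq_one_of_pow_eq_one hz).le) fun h1 => ?_
  induction k generalizing z with
  | zero =>
    rw [pow_zero, pow_one] at hz
    simp [hz] at h1
  | succ k ih =>
    have hz1 := (norm_eq_one_of_pow_eq_one hz).le
    refine ih (z := z ^ p) (by rw [← pow_mul, ← pow_succ', hz]) ?_
    have hlt : ‖z ^ p - 1 - (z - 1) ^ p‖ < ‖(z - 1) ^ p‖ := by
      refine (norm_pow_prime_sub_one_sub_le hz1).trans_lt ?_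
      rw [norm_pow, h1, one_pow, mul_one]
      exact norm_natCast_prime_lt_one
    have h : z ^ p - 1 = (z ^ p - 1 - (z - 1) ^ p) + (z - 1) ^ p := by ring
    rw [h, IsUltrametricDist.norm_add_eq_max_of_norm_ne_norm hlt.ne, max_eq_right hlt.le,
      norm_pow, h1, one_pow]

/-- So close to `1`, the sum `1 + z + ⋯ + z ^ (p - 1)` has norm exactly `‖p‖`, hence is nonzero, and
`z ^ p = 1` forces `z = 1`. -/
theorem eq_one_of_norm_sub_one_lt (hz : z ^ p ^ k = 1) (h : ‖z - 1‖ < ‖(p : PadicAlgCl p)‖) :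
    z = 1 := by
  induction k generalizing z with
  | zero => simpa using hz
  | succ k ih =>
    have hz1 := (norm_eq_one_of_pow_eq_one hz).le
    have hsum : ‖∑ i ∈ Finset.range p, (z ^ i - 1)‖ < ‖(p : PadicAlgCl p)‖ :=
      (IsUltrametricDist.norm_sum_le_of_forall_le_of_nonneg (norm_nonneg _)
        fun i _ => norm_pow_sub_one_le hz1 i).trans_lt h
    have heq : ∑ i ∈ Finset.range p, z ^ i = ∑ i ∈ Finset.range p, (z ^ i - 1) + p := by
      simp
    have hn : ‖z ^ p - 1‖ = ‖z - 1‖ * ‖(p : PadicAlgCl p)‖ := by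
      rw [← mul_geom_sum, norm_mul, heq, IsUltrametricDist.norm_add_eq_max_of_norm_ne_norm hsum.ne,
        max_eq_right hsum.le]
    have hp1 : z ^ p = 1 := by
      refine ih (by rw [← pow_mul, ← pow_succ', hz]) ?_
      exact (norm_pow_sub_one_le hz1 p).trans_lt h
    rw [hp1, sub_self, norm_zero, eq_comm, mul_eq_zero] at hn
    exact sub_eq_zero.1 (norm_eq_zero.1 (hn.resolve_right norm_natCast_prime_pos.ne'))

/-- As long as `‖p‖` is below the relevant powers of `ρ`, each `p`-th power gains at least one
factor `ρ`. -/
theorem norm_pow_prime_pow_sub_one_le (hz : ‖z‖ ≤ 1) {ρ : ℝ} (hρ1 : ρ ≤ 1) {N : ℕ}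
    (hzρ : ‖z - 1‖ ≤ ρ) (hp : ‖(p : PadicAlgCl p)‖ ≤ ρ ^ N) {t : ℕ} (ht : t ≤ N) :
    ‖z ^ p ^ t - 1‖ ≤ ρ ^ (t + 1) := by
  have hρ0 : 0 ≤ ρ := (norm_nonneg _).trans hzρ
  induction t with
  | zero => simpa using hzρ
  | succ t ih =>
    have ih := ih (by omega)
    rw [pow_succ, pow_mul]
    have hw : ‖z ^ p ^ t‖ ≤ 1 := by
      rw [norm_pow]; exact pow_le_one₀ (norm_nonneg _) hz
    refine (norm_pow_prime_sub_one_le hw).trans (max_le ?_ ?_)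
    · refine (pow_le_pow_left₀ (norm_nonneg _) ih p).trans ?_
      rw [← pow_mul]
      refine pow_le_pow_of_le_one hρ0 hρ1 ?_
      have := (Fact.out : p.Prime).two_le
      nlinarith
    · refine (mul_le_mul hp ih (norm_nonneg _) (by positivity)).trans ?_
      rw [← pow_add]
      exact pow_le_pow_of_le_one hρ0 hρ1 (by omega)

/-- A `p`-power root of unity of large order is close to the unit circle around `1`. -/
theorem norm_prime_lt_norm_sub_one_pow (hz : z ^ p ^ k = 1) {N : ℕ} (hN : z ^ p ^ N ≠ 1) :
    ‖(p : PadicAlgCl p)‖ < ‖z - 1‖ ^ N := by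
  by_contra! hle
  set ρ := ‖z - 1‖ with hρ
  have hρ0 : 0 ≤ ρ := norm_nonneg _
  have hρ1 : ρ < 1 := norm_sub_one_lt_one hz
  have hz1 := (norm_eq_one_of_pow_eq_one hz).le
  -- Iterated `p`-th powers gain a factor `ρ` each time until they reach the floor `‖p‖ * ρ`. If `ρ
  -- ^ N ≤ ‖p‖`, both bounds are below `‖p‖` at `t = N`, which forces `z ^ p ^ N = 1`.
  have key : ∀ t : ℕ, ‖z ^ p ^ t - 1‖ ≤ max (ρ ^ (t + 1)) (‖(p : PadicAlgCl p)‖ * ρ) := by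
    intro t
    induction t with
    | zero => simp [hρ]
    | succ t ih =>
      rw [pow_succ, pow_mul]
      have hw : ‖z ^ p ^ t‖ ≤ 1 := by
        rw [norm_pow]; exact pow_le_one₀ (norm_nonneg _) hz1
      refine (norm_pow_prime_sub_one_le hw).trans (max_le ?_ ?_)
      · rcases le_max_iff.1 ih with h | h
        · refine le_max_of_le_left ((pow_le_pow_left₀ (norm_nonneg _) h p).trans ?_)
          rw [← pow_mul]
          refine pow_le_pow_of_le_one hρ0 hρ1.le ?_
          have := (Fact.out : p.Prime).two_le
          nlinarith
        · refine le_max_of_le_right ((pow_le_of_le_one (norm_nonneg _) (norm_sub_one_le_one hw)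
            (Fact.out : p.Prime).ne_zero).trans h)
      · refine le_max_of_le_right (mul_le_mul_of_nonneg_left ?_ (norm_nonneg _))
        exact norm_pow_sub_one_le hz1 _
  refine hN (eq_one_of_norm_sub_one_lt (k := k) ?_ ((key N).trans_lt (max_lt ?_ ?_)))
  · rw [← pow_mul, mul_comm, pow_mul, hz, one_pow]
  · rw [pow_succ]
    refine (mul_le_mul_of_nonneg_right hle hρ0).trans_lt ?_
    exact mul_lt_of_lt_one_right norm_natCast_prime_pos hρ1
  · exact mul_lt_of_lt_one_right norm_natCast_prime_pos hρ1

theorem norm_rootPow_sub_one_le (hz : z ^ p ^ k = 1) (a : ℤ_[p]) :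
    ‖rootPow z a - 1‖ ≤ ‖z - 1‖ :=
  norm_pow_sub_one_le (norm_eq_one_of_pow_eq_one hz).le _

end Norm

/-! ### Characters as power series -/

section Character

variable {n : ℕ} (F : IntermediateField ℚ_[p] (PadicAlgCl p))

theorem coeff_character (a : Fin n → ℤ_[p]) (m : Fin n →₀ ℕ) :
    MvPowerSeries.coeff m (character F a) =
      algebraMap ℤ_[p] (intRing F) (∏ i, Ring.choose (a i) (m i)) := rfl

theorem continuous_character : Continuous (character (n := n) F) := by
  refine continuous_pi fun m => (continuous_algebraMap_intRing F).comp ?_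
  exact continuous_finsetProd _ fun i _ =>
    (PadicInt.continuous_choose (m i)).comp (continuous_apply i)

theorem character_zero : character F (0 : Fin n → ℤ_[p]) = 1 := by
  classical
  ext m
  rw [coeff_character, MvPowerSeries.coeff_one]
  split_ifs with h
  · simp [h]
  · obtain ⟨i, hi⟩ := Finsupp.ne_iff.1 h
    rw [Finset.prod_eq_zero (Finset.mem_univ i), map_zero]
    exact Ring.choose_zero_pos _ (Nat.pos_of_ne_zero hi)

/-- This is Pascal's rule in the `i`-th variable; multiplicativity in general follows by continuity
in the exponents. -/
theorem character_add_single (a : Fin n → ℤ_[p]) (i : Fin n) :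
    character F (a + Pi.single i 1) = character F a * (1 + MvPowerSeries.X i) := by
  classical
  ext m
  congr 1
  rw [mul_add, mul_one, map_add, MvPowerSeries.X, MvPowerSeries.coeff_mul_monomial, mul_one,
    coeff_character, coeff_character]
  have hprod : ∀ (b : Fin n → ℤ_[p]) (l : Fin n →₀ ℕ), (∀ j ≠ i, b j = a j ∧ l j = m j) →
      ∏ j, Ring.choose (b j) (l j) =
        Ring.choose (b i) (l i) * ∏ j ∈ Finset.univ.erase i, Ring.choose (a j) (m j) := by
    intro b l h
    rw [← Finset.mul_prod_erase _ _ (Finset.mem_univ i)]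
    refine congrArg _ (Finset.prod_congr rfl fun j hj => ?_)
    rw [(h j (Finset.ne_of_mem_erase hj)).1, (h j (Finset.ne_of_mem_erase hj)).2]
  rw [hprod (a + Pi.single i 1) m fun j hj => by simp [hj], hprod a m fun j _ => ⟨rfl, rfl⟩]
  split_ifs with h
  · rw [coeff_character, hprod a _ fun j hj => by simp [hj], ← map_add, ← add_mul]
    have hm : 1 ≤ m i := by simpa using h
    obtain ⟨l, hl⟩ := Nat.exists_eq_add_of_le' hm
    have h1 : (m - Finsupp.single i 1 : Fin n →₀ ℕ) i = l := by simp [hl]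
    rw [h1, hl, Pi.add_apply, Pi.single_eq_same, Ring.choose_succ_succ, add_comm (Ring.choose _ l)]
  · have hm : m i = 0 := by
      simpa using h
    simp [hm]

theorem character_single (i : Fin n) :
    character F (Pi.single i (1 : ℤ_[p])) = 1 + MvPowerSeries.X i := by
  simpa [character_zero] using character_add_single F (0 : Fin n → ℤ_[p]) i

theorem character_add (a b : Fin n → ℤ_[p]) :
    character F (a + b) = character F a * character F b := by
  have h : ∀ b, b ∈ {b : Fin n → ℤ_[p] |
      ∀ a, character F (a + b) = character F a * character F b} := by
    refine mem_of_isClosed ?_ ?_ ?_ ?_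
    · rw [Set.ofPred_forall]
      refine isClosed_iInter fun a => isClosed_eq ?_ ?_
      · exact (continuous_character F).comp (continuous_const.add continuous_id)
      · exact continuous_const.mul (continuous_character F)
    · intro a
      rw [add_zero, character_zero, mul_one]
    · intro b hb c hc a
      rw [← add_assoc, hc, hb, hc b, mul_assoc]
    · intro i a
      rw [character_single, character_add_single]
  exact h b a

theorem baseChange_character {F K : IntermediateField ℚ_[p] (PadicAlgCl p)} (h : F ≤ K)
    (a : Fin n → ℤ_[p]) : baseChange n h (character F a) = character K a := by
  ext m
  rw [baseChange, MvPowerSeries.coeff_map, coeff_character, coeff_character]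
  rfl

theorem constantCoeff_character (a : Fin n → ℤ_[p]) :
    MvPowerSeries.constantCoeff (character F a) = 1 := by
  rw [← MvPowerSeries.coeff_zero_eq_constantCoeff_apply, coeff_character]
  simp

end Character

theorem isTopologicallyNilpotent_sub_one {K : IntermediateField ℚ_[p] (PadicAlgCl p)}
    {z : intRing K} {k : ℕ} (hz : z ^ p ^ k = 1) : IsTopologicallyNilpotent (z - 1) := by
  refine tendsto_pow_atTop_nhds_zero_of_norm_lt_one ?_
  exact norm_sub_one_lt_one (z := (z : PadicAlgCl p)) (k := k) (by exact_mod_cast congrArg Subtype.val hz)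

/-! ### Evaluation at torsion points -/

section Eval

variable {n : ℕ}

/-- The field obtained from `F` by adjoining the coordinates of a point. -/
theorem exists_finite_extension (F : IntermediateField ℚ_[p] (PadicAlgCl p))
    [FiniteDimensional ℚ_[p] F] {ι : Type*} [Finite ι] (x : ι → PadicAlgCl p) :
    ∃ K : IntermediateField ℚ_[p] (PadicAlgCl p), F ≤ K ∧ FiniteDimensional ℚ_[p] K ∧
      ∀ i, x i ∈ K := by
  have : FiniteDimensional ℚ_[p] (IntermediateField.adjoin ℚ_[p] (Set.range x)) := by
    have : Finite (Set.range x) := Set.finite_range x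
    exact IntermediateField.finiteDimensional_adjoin fun y _ => Algebra.IsIntegral.isIntegral y
  refine ⟨F ⊔ IntermediateField.adjoin ℚ_[p] (Set.range x), le_sup_left, inferInstance,
    fun i => ?_⟩
  exact (le_sup_right : _ ≤ F ⊔ _) (IntermediateField.subset_adjoin _ _ ⟨i, rfl⟩)

theorem exists_lift_intRing {K : IntermediateField ℚ_[p] (PadicAlgCl p)}
    {ζ : Fin n → PadicAlgCl p} (hζ : IsTorsionPoint p ζ) (hK : ∀ i, ζ i ∈ K) :
    ∃ ξ : Fin n → intRing K, IsTorsionPoint p ξ ∧ ∀ i, (ξ i : PadicAlgCl p) = ζ i := by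
  have hn : ∀ i, ζ i ∈ intRing K := fun i => by
    obtain ⟨k, hk⟩ := hζ i
    exact mem_intRing_iff.2 ⟨(norm_eq_one_of_pow_eq_one hk).le, hK i⟩
  refine ⟨fun i => ⟨ζ i, hn i⟩, fun i => ?_, fun i => rfl⟩
  obtain ⟨k, hk⟩ := hζ i
  exact ⟨k, Subtype.ext (by simpa using hk)⟩

/-- The evaluation is carried out in `𝒪_K` for a finite extension `K` containing the coordinates,
since there compactness gives completeness; the result is then embedded in the algebraic closure. -/
theorem exists_eval (F : IntermediateField ℚ_[p] (PadicAlgCl p)) [FiniteDimensional ℚ_[p] F]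
    {ζ : Fin n → PadicAlgCl p} (hζ : IsTorsionPoint p ζ) :
    ∃ E : TorusRing n F →+* PadicAlgCl p, Continuous E ∧
      (∀ c, E (MvPowerSeries.C c) = c) ∧ (∀ i, E (MvPowerSeries.X i) = ζ i - 1) ∧
      ∀ f : TorusRing n F, HasSum (fun m : Fin n →₀ ℕ =>
        ((MvPowerSeries.coeff m f : intRing F) : PadicAlgCl p) * ∏ i, (ζ i - 1) ^ m i) (E f) := by
  obtain ⟨K, hFK, hK, hζK⟩ := exists_finite_extension F ζ
  obtain ⟨ξ, hξ, hξζ⟩ := exists_lift_intRing hζ hζK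
  have hev : MvPowerSeries.HasEval (fun i => ξ i - 1) :=
    ⟨fun i => isTopologicallyNilpotent_sub_one (hξ i).choose_spec, by
      simp [Filter.cofinite_eq_bot]⟩
  have hφ := continuous_inclusion_intRing hFK
  let v : intRing K →+* PadicAlgCl p := (intRing K).val
  have hcoe : Continuous v := continuous_subtype_val
  refine ⟨v.comp (MvPowerSeries.eval₂Hom hφ hev), ?_, ?_, ?_, ?_⟩
  · refine hcoe.comp ?_
    rw [MvPowerSeries.coe_eval₂Hom]
    exact MvPowerSeries.continuous_eval₂ hφ hev
  · intro c
    rw [RingHom.comp_apply, MvPowerSeries.coe_eval₂Hom, MvPowerSeries.eval₂_C]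
    rfl
  · intro i
    rw [RingHom.comp_apply, MvPowerSeries.coe_eval₂Hom, MvPowerSeries.eval₂_X, ← hξζ]
    rfl
  · intro f
    have := (MvPowerSeries.hasSum_eval₂ hφ hev f).map v hcoe
    rw [← MvPowerSeries.coe_eval₂Hom hφ hev] at this
    refine this.congr_fun fun m => ?_
    simp only [Function.comp_apply, map_mul]
    congr 1
    rw [Finsupp.prod_fintype _ _ (by simp), map_prod]
    refine Finset.prod_congr rfl fun i _ => ?_
    rw [map_pow, ← hξζ]
    rfl

/-- Evaluation of power series at a torsion point. -/
def evalAt (F : IntermediateField ℚ_[p] (PadicAlgCl p)) [FiniteDimensional ℚ_[p] F]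
    {ζ : Fin n → PadicAlgCl p} (hζ : IsTorsionPoint p ζ) : TorusRing n F →+* PadicAlgCl p :=
  (exists_eval F hζ).choose

variable (F : IntermediateField ℚ_[p] (PadicAlgCl p)) [FiniteDimensional ℚ_[p] F]
    {ζ : Fin n → PadicAlgCl p} (hζ : IsTorsionPoint p ζ)

theorem continuous_evalAt : Continuous (evalAt F hζ) := (exists_eval F hζ).choose_spec.1

theorem evalAt_C (c : intRing F) : evalAt F hζ (MvPowerSeries.C c) = c :=
  (exists_eval F hζ).choose_spec.2.1 c

theorem evalAt_X (i : Fin n) : evalAt F hζ (MvPowerSeries.X i) = ζ i - 1 :=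
  (exists_eval F hζ).choose_spec.2.2.1 i

theorem hasSum_evalAt (f : TorusRing n F) : HasSum (fun m : Fin n →₀ ℕ =>
    ((MvPowerSeries.coeff m f : intRing F) : PadicAlgCl p) * ∏ i, (ζ i - 1) ^ m i)
    (evalAt F hζ f) :=
  (exists_eval F hζ).choose_spec.2.2.2 f

variable {F}

theorem vanishesAt_iff (f : TorusRing n F) : VanishesAt f ζ ↔ evalAt F hζ f = 0 :=
  ⟨fun h => (hasSum_evalAt F hζ f).unique h, fun h => by
    have := hasSum_evalAt F hζ f
    rwa [h] at this⟩

omit [FiniteDimensional ℚ_[p] F] in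
theorem vanishesAt_baseChange_iff {K : IntermediateField ℚ_[p] (PadicAlgCl p)} (h : F ≤ K)
    (f : TorusRing n F) (ξ : Fin n → PadicAlgCl p) :
    VanishesAt (baseChange n h f) ξ ↔ VanishesAt f ξ := Iff.rfl

variable (F)

theorem evalAt_character (a : Fin n → ℤ_[p]) :
    evalAt F hζ (character F a) = torsPow ζ a := by
  refine congr_fun (eq_of_continuous_of_single
    (f := fun a => evalAt F hζ (character F a)) (g := fun a => torsPow ζ a)
    ((continuous_evalAt F hζ).comp (continuous_character F)) (continuous_torsPow hζ) ?_
    (torsPow_zero hζ) ?_ (torsPow_add hζ) ?_) a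
  · simp [character_zero]
  · intro a b
    simp [character_add]
  · intro i
    simp [character_single, evalAt_X, torsPow_single hζ]

end Eval

/-! ### Translations and homomorphisms of formal tori -/

section Subst

variable {n d : ℕ} (K : IntermediateField ℚ_[p] (PadicAlgCl p)) [FiniteDimensional ℚ_[p] K]
  {ζ : Fin n → intRing K} (hζ : IsTorsionPoint p ζ)
  (L : (Fin n → ℤ_[p]) →ₗ[ℤ_[p]] (Fin d → ℤ_[p]))

theorem exists_subst {ζ : Fin n → intRing K} (hζ : IsTorsionPoint p ζ)
    (L : (Fin n → ℤ_[p]) →ₗ[ℤ_[p]] (Fin d → ℤ_[p])) :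
    ∃ φ : TorusRing n K →+* TorusRing d K, Continuous φ ∧
      (∀ c, φ (MvPowerSeries.C c) = MvPowerSeries.C c) ∧
      ∀ i, φ (MvPowerSeries.X i) =
        MvPowerSeries.C (ζ i) * character K (L (Pi.single i 1)) - 1 := by
  have hev : MvPowerSeries.HasEval (fun i : Fin n =>
      (MvPowerSeries.C (ζ i) * character K (L (Pi.single i 1)) - 1 : TorusRing d K)) := by
    refine ⟨fun i => ?_, by simp [Filter.cofinite_eq_bot]⟩
    -- Only the constant term `ζ i - 1` matters, and it is topologically nilpotent.
    refine (MvPowerSeries.LinearTopology.isTopologicallyNilpotent_iff_constantCoeff _).2 ?_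
    simp only [map_sub, map_mul, constantCoeff_character, MvPowerSeries.constantCoeff_C, map_one,
      mul_one]
    exact isTopologicallyNilpotent_sub_one (hζ i).choose_spec
  have hC : Continuous (MvPowerSeries.C : intRing K →+* TorusRing d K) := continuous_C
  refine ⟨MvPowerSeries.eval₂Hom hC hev, ?_, ?_, ?_⟩
  · rw [MvPowerSeries.coe_eval₂Hom]
    exact MvPowerSeries.continuous_eval₂ hC hev
  · intro c
    rw [MvPowerSeries.coe_eval₂Hom, MvPowerSeries.eval₂_C]
  · intro i
    rw [MvPowerSeries.coe_eval₂Hom, MvPowerSeries.eval₂_X]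

/-- The substitution `1 + X_i ↦ ζ_i χ_i`, where `χ_i` is the image of the `i`-th coordinate
character under the linear map `L`: restriction of functions along the homomorphism of formal tori
dual to `L`, followed by translation by `ζ`. -/
def substHom {ζ : Fin n → intRing K} (hζ : IsTorsionPoint p ζ)
    (L : (Fin n → ℤ_[p]) →ₗ[ℤ_[p]] (Fin d → ℤ_[p])) : TorusRing n K →+* TorusRing d K :=
  (exists_subst K hζ L).choose

theorem continuous_substHom : Continuous (substHom K hζ L) :=
  (exists_subst K hζ L).choose_spec.1

theorem substHom_C (c : intRing K) :
    substHom K hζ L (MvPowerSeries.C c) = MvPowerSeries.C c :=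
  (exists_subst K hζ L).choose_spec.2.1 c

theorem substHom_X (i : Fin n) : substHom K hζ L (MvPowerSeries.X i) =
    MvPowerSeries.C (ζ i) * character K (L (Pi.single i 1)) - 1 :=
  (exists_subst K hζ L).choose_spec.2.2 i

theorem substHom_character (a : Fin n → ℤ_[p]) : substHom K hζ L (character K a) =
    MvPowerSeries.C (torsPow ζ a) * character K (L a) := by
  refine congr_fun (eq_of_continuous_of_single
    (f := fun a => substHom K hζ L (character K a))
    (g := fun a => MvPowerSeries.C (torsPow ζ a) * character K (L a))
    ((continuous_substHom K hζ L).comp (continuous_character K))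
    ((continuous_C.comp (continuous_torsPow hζ)).mul
      ((continuous_character K).comp (continuous_linearMap L))) ?_ ?_ ?_ ?_ ?_) a
  · simp [character_zero]
  · simp [character_zero, torsPow_zero hζ]
  · intro a b
    simp [character_add]
  · intro a b
    simp only [torsPow_add hζ, map_add, map_mul, character_add]
    ring
  · intro i
    simp [character_single, substHom_X, torsPow_single hζ]

theorem evalAt_substHom {η : Fin d → PadicAlgCl p} (hη : IsTorsionPoint p η)
    {ξ : Fin n → PadicAlgCl p} (hξ : IsTorsionPoint p ξ)
    (h : ∀ i, ξ i = ζ i * torsPow η (L (Pi.single i 1))) (f : TorusRing n K) :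
    evalAt K hη (substHom K hζ L f) = evalAt K hξ f := by
  refine RingHom.congr_fun (f := (evalAt K hη).comp (substHom K hζ L)) (g := evalAt K hξ) ?_ f
  refine ringHom_eq_of_continuous
    ((continuous_evalAt K hη).comp (continuous_substHom K hζ L)) (continuous_evalAt K hξ) ?_ ?_
  · intro c
    simp [substHom_C, evalAt_C]
  · intro i
    simp [substHom_X, evalAt_C, evalAt_X, evalAt_character, h]

end Subst

/-! ### Coordinates adapted to a generic ultrafilter -/

section Flag

variable {Ω : Type*} {n : ℕ}

/-- Along the ultrafilter `U`, the character `a` is infinitely closer to `1` than the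
character `b`. -/
def Closer (U : Ultrafilter Ω) (z : Ω → Fin n → PadicAlgCl p) (a b : Fin n → ℤ_[p]) : Prop :=
  ∀ N : ℕ, ∀ᶠ ω in U, ‖torsPow (z ω) a - 1‖ < ‖torsPow (z ω) b - 1‖ ^ N

/-- No nontrivial character is trivial along the ultrafilter `U`. -/
def IsGeneric (U : Ultrafilter Ω) (z : Ω → Fin n → PadicAlgCl p) : Prop :=
  ∀ a : Fin n → ℤ_[p], a ≠ 0 → ∀ᶠ ω in U, torsPow (z ω) a ≠ 1

variable {U : Ultrafilter Ω} {z : Ω → Fin n → PadicAlgCl p}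

theorem Closer.add (hz : ∀ ω, IsTorsionPoint p (z ω)) {a a' b : Fin n → ℤ_[p]}
    (ha : Closer U z a b) (ha' : Closer U z a' b) : Closer U z (a + a') b := by
  intro N
  filter_upwards [ha N, ha' N] with ω h h'
  obtain ⟨k, hk⟩ := (hz ω).exists_pow
  have heq : torsPow (z ω) (a + a') - 1 =
      torsPow (z ω) a * (torsPow (z ω) a' - 1) + (torsPow (z ω) a - 1) := by
    rw [torsPow_add (hz ω)]; ring
  rw [heq]
  refine (IsUltrametricDist.norm_add_le_max _ _).trans_lt (max_lt ?_ h)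
  rwa [norm_mul, norm_eq_one_of_pow_eq_one (torsPow_pow_eq_one hk a), one_mul]

theorem Closer.smul (hz : ∀ ω, IsTorsionPoint p (z ω)) {a b : Fin n → ℤ_[p]}
    (ha : Closer U z a b) (c : ℤ_[p]) : Closer U z (c • a) b := by
  intro N
  filter_upwards [ha N] with ω h
  obtain ⟨k, hk⟩ := (hz ω).exists_pow
  rw [torsPow_smul (hz ω)]
  exact (norm_rootPow_sub_one_le (torsPow_pow_eq_one hk a) c).trans_lt h

/-- Genericity applied to `p ^ N • a` says that the value of `a` has order exceeding `p ^ N`. In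
effect its distance to `1` tends to `1` along `U`. -/
theorem IsGeneric.norm_prime_lt (hz : ∀ ω, IsTorsionPoint p (z ω)) (hU : IsGeneric U z)
    {a : Fin n → ℤ_[p]} (ha : a ≠ 0) (N : ℕ) :
    ∀ᶠ ω in U, ‖(p : PadicAlgCl p)‖ < ‖torsPow (z ω) a - 1‖ ^ N := by
  have h0 : ((p ^ N : ℕ) : ℤ_[p]) • a ≠ 0 :=
    smul_ne_zero (by exact_mod_cast pow_ne_zero _ (Fact.out : p.Prime).ne_zero) ha
  filter_upwards [hU _ h0] with ω hω
  obtain ⟨k, hk⟩ := (hz ω).exists_pow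
  rw [torsPow_natCast_smul (hz ω)] at hω
  exact norm_prime_lt_norm_sub_one_pow (torsPow_pow_eq_one hk a) hω

/-- If along `U` the character `a` takes values in the group generated by the values of `b`, then
subtracting a suitable multiple of `b` makes it infinitely closer to `1` than `b`. -/
theorem exists_closer_sub_smul (hz : ∀ ω, IsTorsionPoint p (z ω)) (hU : IsGeneric U z)
    {a b : Fin n → ℤ_[p]} (hb : b ≠ 0)
    (hab : ∀ᶠ ω in U, orderOf (torsPow (z ω) a) ≤ orderOf (torsPow (z ω) b)) :
    ∃ c : ℤ_[p], Closer U z (a - c • b) b := by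
  have hex : ∀ ω, ∃ c : ℕ, orderOf (torsPow (z ω) a) ≤ orderOf (torsPow (z ω) b) →
      torsPow (z ω) b ^ c = torsPow (z ω) a := by
    intro ω
    obtain ⟨k, hk⟩ := (hz ω).exists_pow
    by_cases h : orderOf (torsPow (z ω) a) ≤ orderOf (torsPow (z ω) b)
    · obtain ⟨i, -, hi⟩ := (Nat.dvd_prime_pow Fact.out).1
        (orderOf_dvd_of_pow_eq_one (torsPow_pow_eq_one hk a))
      obtain ⟨j, -, hj⟩ := (Nat.dvd_prime_pow Fact.out).1
        (orderOf_dvd_of_pow_eq_one (torsPow_pow_eq_one hk b))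
      rw [hi, hj] at h
      have hij := (Nat.pow_le_pow_iff_right (Fact.out : p.Prime).one_lt).1 h
      have : NeZero (p ^ j) := ⟨pow_ne_zero _ (Fact.out : p.Prime).ne_zero⟩
      have hprim : IsPrimitiveRoot (torsPow (z ω) b) (p ^ j) := by
        rw [← hj]; exact IsPrimitiveRoot.orderOf _
      obtain ⟨c, -, hc⟩ := hprim.eq_pow_of_pow_eq_one
        (orderOf_dvd_iff_pow_eq_one.1 (by rw [hi]; exact pow_dvd_pow p hij))
      exact ⟨c, fun _ => hc⟩
    · exact ⟨0, fun h' => absurd h' h⟩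
  choose c hc using hex
  -- The exponent expressing `a` through `b` depends on the point; by compactness of `ℤ_p` it has a
  -- limit along `U`.
  obtain ⟨c₀, -, hc₀⟩ := isCompact_univ.ultrafilter_le_nhds
    (U.map fun ω => ((c ω : ℕ) : ℤ_[p])) (by simp)
  refine ⟨c₀, fun N => ?_⟩
  have hball : ∀ᶠ ω in U, ((c ω : ℕ) : ℤ_[p]) ∈ Metric.ball c₀ ((p : ℝ) ^ (-(N : ℤ))) :=
    hc₀ (Metric.ball_mem_nhds _ (zpow_pos (by exact_mod_cast (Fact.out : p.Prime).pos) _))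
  filter_upwards [hball, hab, hU b hb, hU.norm_prime_lt hz hb N] with ω hω hord hb1 hpN
  obtain ⟨k, hk⟩ := (hz ω).exists_pow
  have hbk := torsPow_pow_eq_one hk b
  rw [Metric.mem_ball, dist_eq_norm] at hω
  obtain ⟨u, hu⟩ := Ideal.mem_span_singleton.1 ((PadicInt.norm_le_pow_iff_mem_span_pow _ N).1 hω.le)
  -- Where the exponent is within `p ^ (-N)` of its limit, the difference is a `p ^ N`-th power of a
  -- power of the value of `b`. Its distance to `1` is then at most the exponent-`(N + 1)` power of
  -- that of `b`.
  have hval : torsPow (z ω) (a - c₀ • b) = rootPow (torsPow (z ω) b) u ^ p ^ N := by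
    have h1 : torsPow (z ω) (a - c₀ • b) = rootPow (torsPow (z ω) b) ((c ω : ℤ_[p]) - c₀) := by
      rw [sub_eq_add_neg, torsPow_add (hz ω), ← neg_smul, torsPow_smul (hz ω), sub_eq_add_neg,
        rootPow_add hbk, rootPow_natCast hbk, hc ω hord]
    rw [h1, hu]
    have h2 := rootPow_mul hbk u ((p ^ N : ℕ) : ℤ_[p])
    rw [rootPow_natCast (rootPow_pow_eq_one hbk u)] at h2
    rw [← h2]
    push_cast
    rfl
  have hlt := norm_sub_one_lt_one hbk
  have hpos : 0 < ‖torsPow (z ω) b - 1‖ := norm_pos_iff.2 (sub_ne_zero.2 hb1)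
  rw [hval]
  refine (norm_pow_prime_pow_sub_one_le (norm_eq_one_of_pow_eq_one
    (rootPow_pow_eq_one hbk u)).le hlt.le (norm_rootPow_sub_one_le hbk u) hpN.le le_rfl).trans_lt ?_
  exact pow_lt_pow_right_of_lt_one₀ hpos hlt (Nat.lt_succ_self N)

/-- Elimination by induction on `k`: among the characters not yet treated, one of largest order
serves as pivot, and multiples of it are subtracted from those after it. Earlier relations survive
because being infinitely closer is stable under linear combinations. -/
theorem exists_basis_closer_of_le (hz : ∀ ω, IsTorsionPoint p (z ω)) (hU : IsGeneric U z) :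
    ∀ k ≤ n, ∃ b : Module.Basis (Fin n) ℤ_[p] (Fin n → ℤ_[p]),
      ∀ i j : Fin n, (i : ℕ) < k → i < j → Closer U z (b j) (b i) := by
  intro k
  induction k with
  | zero => exact fun _ => ⟨Pi.basisFun _ _, fun i j hi => absurd hi (Nat.not_lt_zero _)⟩
  | succ k ih =>
    intro hk
    obtain ⟨b, hb⟩ := ih (by omega)
    let κ : Fin n := ⟨k, hk⟩
    have hmax : ∀ᶠ ω in U, ∃ i : {i : Fin n // κ ≤ i}, ∀ j : {i : Fin n // κ ≤ i},
        orderOf (torsPow (z ω) (b j)) ≤ orderOf (torsPow (z ω) (b i)) := by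
      refine Eventually.of_forall fun ω => ?_
      have : Nonempty {i : Fin n // κ ≤ i} := ⟨⟨κ, le_rfl⟩⟩
      exact Finite.exists_max fun i : {i : Fin n // κ ≤ i} => orderOf (torsPow (z ω) (b i))
    -- The pivot depends on the point, but there are finitely many candidates, so one of them works
    -- along `U`.
    obtain ⟨⟨i₀, hi₀⟩, hmax⟩ := Ultrafilter.eventually_exists_iff.1 hmax
    let b₁ := b.reindex (Equiv.swap κ i₀)
    have hb₁ : ∀ i, b₁ i = b (Equiv.swap κ i₀ i) := fun i => by
      rw [Module.Basis.reindex_apply, Equiv.symm_swap]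
    have hκ : b₁ κ = b i₀ := by rw [hb₁, Equiv.swap_apply_left]
    have hswap : ∀ j, κ ≤ j → κ ≤ Equiv.swap κ i₀ j := by
      intro j hj
      rw [Equiv.swap_apply_def]
      split_ifs
      exacts [hi₀, le_rfl, hj]
    have hlow : ∀ i, i < κ → b₁ i = b i := by
      intro i hi
      rw [hb₁, Equiv.swap_apply_of_ne_of_ne hi.ne (hi.trans_le hi₀).ne]
    have hex : ∀ j, ∃ c : ℤ_[p], κ < j → Closer U z (b₁ j - c • b₁ κ) (b₁ κ) := by
      intro j
      by_cases hj : κ < j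
      · obtain ⟨c, hc⟩ := exists_closer_sub_smul (a := b₁ j) (b := b₁ κ) hz hU (b₁.ne_zero κ) (by
          filter_upwards [hmax] with ω hω
          rw [hκ, hb₁ j]
          exact hω ⟨_, hswap j hj.le⟩)
        exact ⟨c, fun _ => hc⟩
      · exact ⟨0, fun h => absurd h hj⟩
    choose c hc using hex
    -- All subtractions are performed at once by a transvection, which keeps a basis.
    let f : Module.Dual ℤ_[p] (Fin n → ℤ_[p]) :=
      b₁.constr ℤ_[p] fun j => if κ < j then -c j else 0
    have hf : ∀ j, f (b₁ j) = if κ < j then -c j else 0 := fun j => b₁.constr_basis _ _ j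
    have hfκ : f (b₁ κ) = 0 := by rw [hf, if_neg (lt_irrefl _)]
    let b₂ := b₁.map (LinearEquiv.transvection hfκ)
    have hb₂ : ∀ j, b₂ j = b₁ j + f (b₁ j) • b₁ κ := fun j => by
      rw [Module.Basis.map_apply]
      rfl
    have hle : ∀ j, j ≤ κ → b₂ j = b₁ j := fun j hj => by
      rw [hb₂, hf, if_neg hj.not_gt, zero_smul, add_zero]
    refine ⟨b₂, fun i j hi hij => ?_⟩
    rcases (Nat.lt_succ_iff_lt_or_eq.1 hi) with hlt | heq
    · have hiκ : i < κ := hlt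
      have hup : ∀ l, κ ≤ l → Closer U z (b₁ l) (b i) := fun l hl => by
        rw [hb₁]
        exact hb i _ hlt (hiκ.trans_le (hswap l hl))
      rw [hle i hiκ.le, hlow i hiκ, hb₂]
      rcases lt_or_ge j κ with hj | hj
      · rw [hf, if_neg hj.not_gt, zero_smul, add_zero, hlow j hj]
        exact hb i j hlt hij
      · exact (hup j hj).add hz ((hup κ le_rfl).smul hz _)
    · have hiκ : i = κ := Fin.ext heq
      rw [hiκ] at hij ⊢
      rw [hle κ le_rfl, hb₂, hf, if_pos hij, neg_smul, ← sub_eq_add_neg]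
      exact hc j hij

/-- A generic ultrafilter of torsion points admits coordinates of infinitely different orders. -/
theorem exists_basis_closer (hz : ∀ ω, IsTorsionPoint p (z ω)) (hU : IsGeneric U z) :
    ∃ b : Module.Basis (Fin n) ℤ_[p] (Fin n → ℤ_[p]),
      ∀ i j : Fin n, i < j → Closer U z (b i) (b j) := by
  obtain ⟨b, hb⟩ := exists_basis_closer_of_le hz hU n le_rfl
  -- The order is reversed so that the most negligible coordinate comes first, matching the
  -- lexicographic order on exponents.
  refine ⟨b.reindex Fin.revPerm, fun i j hij => ?_⟩
  rw [Module.Basis.reindex_apply, Module.Basis.reindex_apply]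
  exact hb _ _ (Fin.is_lt _) (Fin.rev_lt_rev.2 hij)

end Flag

/-! ### The dominant term of a power series -/

section Dominant

variable {n : ℕ}

/-- Discreteness of the value group makes the maximal norm of the coefficients attained and
separates the other norms from it by a fixed factor `r`. The exponent `μ` is the lexicographically
smallest one attaining the maximum. -/
theorem exists_dominant_coeff (K : IntermediateField ℚ_[p] (PadicAlgCl p))
    [FiniteDimensional ℚ_[p] K] {f : TorusRing n K} (hf : f ≠ 0) :
    ∃ (r : ℝ) (μ : Fin n →₀ ℕ), 0 < r ∧ r < 1 ∧ MvPowerSeries.coeff μ f ≠ 0 ∧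
      ∀ m, m ≠ μ → ‖MvPowerSeries.coeff m f‖ ≤ r * ‖MvPowerSeries.coeff μ f‖ ∨
        (‖MvPowerSeries.coeff m f‖ ≤ ‖MvPowerSeries.coeff μ f‖ ∧
          ∃ i, (∀ j < i, μ j = m j) ∧ μ i < m i) := by
  obtain ⟨r, hr0, hr1, hr⟩ := exists_norm_gap K
  obtain ⟨m₀, hm₀⟩ : ∃ m, MvPowerSeries.coeff m f ≠ 0 := by
    by_contra! h
    exact hf (MvPowerSeries.ext fun m => by simp [h m])
  have hbdd : BddAbove (Set.range fun m => ‖MvPowerSeries.coeff m f‖) :=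
    ⟨1, by rintro _ ⟨m, rfl⟩; exact norm_intRing_le_one _⟩
  set s := ⨆ m, ‖MvPowerSeries.coeff m f‖ with hs
  have hs0 : 0 < s := (norm_pos_iff.2 hm₀).trans_le (le_ciSup hbdd m₀)
  -- A coefficient above `r * s` is already maximal: anything larger would be larger by a factor at
  -- least `r⁻¹`, exceeding the supremum.
  obtain ⟨m₁, hm₁⟩ : ∃ m₁, r * s < ‖MvPowerSeries.coeff m₁ f‖ :=
    exists_lt_of_lt_ciSup (mul_lt_of_lt_one_left hs0 hr1)
  have hgap : ∀ m m', ‖MvPowerSeries.coeff m f‖ < ‖MvPowerSeries.coeff m' f‖ →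
      ‖MvPowerSeries.coeff m f‖ ≤ r * ‖MvPowerSeries.coeff m' f‖ := by
    intro m m' h
    have h0 : 0 < ‖MvPowerSeries.coeff m' f‖ := (norm_nonneg _).trans_lt h
    have := hr ((MvPowerSeries.coeff m f : intRing K) / (MvPowerSeries.coeff m' f : intRing K) : PadicAlgCl p)
      (K.div_mem (MvPowerSeries.coeff m f).2.2 (MvPowerSeries.coeff m' f).2.2)
      (by rw [norm_div]; exact (div_lt_one h0).2 h)
    rw [norm_div] at this
    exact (div_le_iff₀ h0).1 this
  have hmax : ∀ m, ‖MvPowerSeries.coeff m f‖ ≤ ‖MvPowerSeries.coeff m₁ f‖ := by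
    intro m
    by_contra! h
    have := (hgap m₁ m h).trans (mul_le_mul_of_nonneg_left (le_ciSup hbdd m) hr0.le)
    exact absurd hm₁ this.not_gt
  obtain ⟨μ, hμ, hmin⟩ := WellFounded.has_min (wellFounded_lt (α := Lex (Fin n →₀ ℕ)))
    {m | ‖MvPowerSeries.coeff (ofLex m) f‖ = ‖MvPowerSeries.coeff m₁ f‖} ⟨toLex m₁, rfl⟩
  change ‖MvPowerSeries.coeff (ofLex μ) f‖ = ‖MvPowerSeries.coeff m₁ f‖ at hμ
  refine ⟨r, ofLex μ, hr0, hr1, ?_, fun m hm => ?_⟩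
  · rw [← norm_pos_iff, hμ]
    exact (by positivity : (0 : ℝ) ≤ r * s).trans_lt hm₁
  · rcases (hmax m).lt_or_eq with h | h
    · left
      rw [hμ]
      exact hgap _ _ h
    · right
      refine ⟨by rw [hμ, h], ?_⟩
      have hlt : μ < toLex m :=
        lt_of_le_of_ne (not_lt.1 (hmin (toLex m) h)) fun he => hm (by rw [he]; rfl)
      exact Finsupp.Lex.lt_iff.1 hlt

/-- At the first index where the exponents differ, the extra factor `x i` outweighs everything the
later coordinates contribute to the monomial of `μ`. -/
theorem prod_pow_lt_prod_pow {x : Fin n → ℝ} (hx0 : ∀ i, 0 < x i) (hx1 : ∀ i, x i ≤ 1)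
    {μ m : Fin n →₀ ℕ} {i : Fin n} (hlow : ∀ j < i, μ j = m j) (hi : μ i < m i)
    (hx : x i < ∏ j, if i < j then x j ^ μ j else 1) :
    ∏ j, x j ^ m j < ∏ j, x j ^ μ j := by
  set H := ∏ j, if i < j then x j ^ μ j else 1 with hH
  -- `G` bounds the monomial of `m` by keeping one extra factor at `i` and dropping all later ones.
  set G := ∏ j, if j < i then x j ^ μ j else if j = i then x i ^ (μ i + 1) else 1 with hG
  have hH0 : 0 < H := Finset.prod_pos fun j _ => by split_ifs <;> first | exact pow_pos (hx0 j) _ | exact one_pos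
  have hP0 : 0 < ∏ j, x j ^ μ j := Finset.prod_pos fun j _ => pow_pos (hx0 j) _
  have h1 : ∏ j, x j ^ m j ≤ G := by
    refine Finset.prod_le_prod (fun j _ => (pow_pos (hx0 j) _).le) fun j _ => ?_
    split_ifs with h h'
    · rw [hlow j h]
    · subst h'
      exact pow_le_pow_of_le_one (hx0 _).le (hx1 _) hi
    · exact pow_le_one₀ (hx0 j).le (hx1 j)
  have h2 : G * H = x i * ∏ j, x j ^ μ j := by
    have hxi : x i = ∏ j, if j = i then x i else 1 := by simp
    rw [hxi, hG, hH, ← Finset.prod_mul_distrib, ← Finset.prod_mul_distrib]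
    refine Finset.prod_congr rfl fun j _ => ?_
    rcases lt_trichotomy j i with h | h | h
    · simp [h, h.not_gt, h.ne]
    · subst h
      simp [pow_succ']
    · simp [h, h.not_gt, h.ne']
  refine h1.trans_lt (lt_of_mul_lt_mul_right ?_ hH0.le)
  rw [h2, mul_comm _ H]
  exact mul_lt_mul_of_pos_right hx hP0

/-- Every finite partial sum containing the dominant term has its norm, and this passes to the
limit. -/
theorem ne_zero_of_hasSum_of_dominant {ι E : Type*} [NormedAddCommGroup E] [IsUltrametricDist E]
    {g : ι → E} {s : E} (hs : HasSum g s) {i₀ : ι} (h0 : g i₀ ≠ 0)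
    (h : ∀ i, i ≠ i₀ → ‖g i‖ < ‖g i₀‖) : s ≠ 0 := by
  classical
  have hpos := norm_pos_iff.2 h0
  have hev : ∀ᶠ T : Finset ι in atTop, ‖∑ i ∈ T, g i‖ = ‖g i₀‖ := by
    filter_upwards [eventually_ge_atTop {i₀}] with T hT
    have hmem : i₀ ∈ T := hT (Finset.mem_singleton_self _)
    have hlt : ‖∑ i ∈ T.erase i₀, g i‖ < ‖g i₀‖ := by
      refine Finset.sum_induction _ (fun y => ‖y‖ < ‖g i₀‖) ?_ (by simpa using h0) ?_
      · intro a b ha hb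
        exact (IsUltrametricDist.norm_add_le_max a b).trans_lt (max_lt ha hb)
      · intro i hi
        exact h i (Finset.ne_of_mem_erase hi)
    rw [← Finset.sum_erase_add _ _ hmem,
      IsUltrametricDist.norm_add_eq_max_of_norm_ne_norm hlt.ne, max_eq_right hlt.le]
  have hnorm : ‖s‖ = ‖g i₀‖ :=
    tendsto_nhds_unique hs.norm (tendsto_const_nhds.congr' (hev.mono fun _ h => h.symm))
  exact norm_pos_iff.1 (hnorm ▸ hpos)

/-- Being below all powers passes to products: using exponent `2 * N` for both factors bounds `c ^
2`, and a square root gives the claim. -/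
theorem eventually_lt_prod_pow {Ω ι : Type*} {l : Filter Ω} {c : Ω → ℝ} (hc0 : ∀ ω, 0 ≤ c ω)
    (hc1 : ∀ᶠ ω in l, c ω < 1) (s : Finset ι) {y : ι → Ω → ℝ} (hy0 : ∀ i ω, 0 ≤ y i ω)
    (hy : ∀ i ∈ s, ∀ N : ℕ, ∀ᶠ ω in l, c ω < y i ω ^ N) (N : ℕ) :
    ∀ᶠ ω in l, c ω < (∏ i ∈ s, y i ω) ^ N := by
  classical
  induction s using Finset.induction_on generalizing N with
  | empty => simpa using hc1
  | insert i s hi ih =>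
    filter_upwards [hy i (Finset.mem_insert_self _ _) (N * 2),
      ih (fun j hj => hy j (Finset.mem_insert_of_mem hj)) (N * 2)] with ω h1 h2
    rw [Finset.prod_insert hi]
    have hP : 0 ≤ ∏ j ∈ s, y j ω := Finset.prod_nonneg fun j _ => hy0 j ω
    refine lt_of_pow_lt_pow_left₀ 2 (pow_nonneg (mul_nonneg (hy0 i ω) hP) N) ?_
    rw [← pow_mul, mul_pow, pow_two]
    exact mul_lt_mul'' h1 h2 (hc0 ω) (hc0 ω)

end Dominant

/-! ### Nonvanishing along generic ultrafilters -/

section Generic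

variable {Ω : Type*} {n : ℕ} {U : Ultrafilter Ω} {z : Ω → Fin n → PadicAlgCl p}
  {K : IntermediateField ℚ_[p] (PadicAlgCl p)} [FiniteDimensional ℚ_[p] K]

/-- If the coordinates have infinitely different orders, then a nonzero power series does not
vanish along the ultrafilter. -/
theorem eventually_evalAt_ne_zero_of_closer (hz : ∀ ω, IsTorsionPoint p (z ω))
    (hU : IsGeneric U z)
    (hc : ∀ i j : Fin n, i < j → Closer U z (Pi.single i 1) (Pi.single j 1))
    {f : TorusRing n K} (hf : f ≠ 0) : ∀ᶠ ω in U, evalAt K (hz ω) f ≠ 0 := by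
  obtain ⟨r, μ, hr0, hr1, hμ, hdom⟩ := exists_dominant_coeff K hf
  have hne : ∀ i : Fin n, (Pi.single i 1 : Fin n → ℤ_[p]) ≠ 0 := fun i => by simp
  have hlt1 : ∀ ω i, ‖z ω i - 1‖ < 1 := fun ω i => norm_sub_one_lt_one (hz ω i).choose_spec
  have hslow : ∀ i, ∀ᶠ ω in U,
      ‖z ω i - 1‖ < ∏ j, if i < j then ‖z ω j - 1‖ ^ μ j else 1 := by
    intro i
    have := eventually_lt_prod_pow (l := (U : Filter Ω)) (c := fun ω => ‖z ω i - 1‖)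
      (fun ω => norm_nonneg _) (Eventually.of_forall fun ω => hlt1 ω i) Finset.univ
      (y := fun j ω => if i < j then ‖z ω j - 1‖ ^ μ j else 1)
      (fun j ω => by split_ifs <;> positivity) (fun j _ N => by
        by_cases hij : i < j
        · simp only [if_pos hij, ← pow_mul]
          filter_upwards [hc i j hij (μ j * N)] with ω hω
          rwa [torsPow_single (hz ω), torsPow_single (hz ω)] at hω
        · simp only [if_neg hij, one_pow]
          exact Eventually.of_forall fun ω => hlt1 ω i) 1
    simpa only [pow_one] using this
  have hr : ∀ᶠ ω in U, r < ∏ j, ‖z ω j - 1‖ ^ μ j := by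
    -- With `r ^ k < ‖p‖`, genericity pushes each coordinate power above `r`: the monomial of `μ`
    -- eventually beats the gap between coefficients.
    obtain ⟨k, hk⟩ := exists_pow_lt_of_lt_one (norm_natCast_prime_pos (p := p)) hr1
    have := eventually_lt_prod_pow (l := (U : Filter Ω)) (c := fun _ => r)
      (fun ω => hr0.le) (Eventually.of_forall fun ω => hr1) Finset.univ
      (y := fun j ω => ‖z ω j - 1‖ ^ μ j) (fun j ω => by positivity) (fun j _ N => by
        filter_upwards [hU.norm_prime_lt hz (hne j) (μ j * N * k)] with ω hω
        rw [torsPow_single (hz ω), pow_mul, pow_mul] at hω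
        exact lt_of_pow_lt_pow_left₀ k (by positivity) (hk.trans hω)) 1
    simpa only [pow_one] using this
  have hpos : ∀ᶠ ω in U, ∀ i, z ω i ≠ 1 := by
    rw [eventually_all]
    intro i
    filter_upwards [hU _ (hne i)] with ω hω
    rwa [torsPow_single (hz ω)] at hω
  filter_upwards [eventually_all.2 hslow, hr, hpos] with ω hslow hr hpos
  have hx0 : ∀ i, 0 < ‖z ω i - 1‖ := fun i => norm_pos_iff.2 (sub_ne_zero.2 (hpos i))
  have hnorm : ∀ m : Fin n →₀ ℕ, ‖((MvPowerSeries.coeff m f : intRing K) : PadicAlgCl p) *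
      ∏ i, (z ω i - 1) ^ m i‖ = ‖MvPowerSeries.coeff m f‖ * ∏ i, ‖z ω i - 1‖ ^ m i := by
    intro m
    rw [norm_mul, norm_prod]
    simp only [norm_pow]
    rfl
  have hμ0 : 0 < ‖MvPowerSeries.coeff μ f‖ := norm_pos_iff.2 hμ
  have hP0 : ∀ m : Fin n →₀ ℕ, 0 < ∏ i, ‖z ω i - 1‖ ^ m i :=
    fun m => Finset.prod_pos fun j _ => pow_pos (hx0 j) _
  refine ne_zero_of_hasSum_of_dominant (hasSum_evalAt K (hz ω) f) (i₀ := μ) ?_ fun m hm => ?_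
  · rw [← norm_pos_iff, hnorm]
    exact mul_pos hμ0 (hP0 μ)
  · rw [hnorm, hnorm]
    rcases hdom m hm with h | ⟨h, i, hlow, hi⟩
    · refine (mul_le_mul_of_nonneg_right h (hP0 m).le).trans_lt ?_
      have h1 : ∏ i, ‖z ω i - 1‖ ^ m i ≤ 1 := Finset.prod_le_one
        (fun j _ => by positivity) fun j _ => pow_le_one₀ (norm_nonneg _) (hlt1 ω j).le
      calc r * ‖MvPowerSeries.coeff μ f‖ * ∏ i, ‖z ω i - 1‖ ^ m i
          ≤ r * ‖MvPowerSeries.coeff μ f‖ := mul_le_of_le_one_right (by positivity) h1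
        _ = ‖MvPowerSeries.coeff μ f‖ * r := mul_comm _ _
        _ < _ := mul_lt_mul_of_pos_left hr hμ0
    · refine (mul_le_mul_of_nonneg_right h (hP0 m).le).trans_lt ?_
      exact mul_lt_mul_of_pos_left
        (prod_pow_lt_prod_pow hx0 (fun i => (hlt1 ω i).le) hlow hi (hslow i)) hμ0

omit [Fact p.Prime] in
theorem isTorsionPoint_one {M : Type*} [Monoid M] : IsTorsionPoint p (1 : Fin n → M) :=
  fun _ => ⟨0, by simp⟩

theorem torsPow_one {M : Type*} [CommMonoid M] (a : Fin n → ℤ_[p]) :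
    torsPow (1 : Fin n → M) a = 1 :=
  Finset.prod_eq_one fun _ _ => one_pow _

/-- A power series that vanishes along a generic ultrafilter of torsion points is zero. -/
theorem eq_zero_of_eventually_evalAt_eq_zero (hz : ∀ ω, IsTorsionPoint p (z ω))
    (hU : IsGeneric U z) {f : TorusRing n K} (hf : ∀ᶠ ω in U, evalAt K (hz ω) f = 0) : f = 0 := by
  by_contra hf0
  obtain ⟨b, hb⟩ := exists_basis_closer hz hU
  let e : (Fin n → ℤ_[p]) ≃ₗ[ℤ_[p]] (Fin n → ℤ_[p]) := b.equivFun
  have he : ∀ i, e.symm (Pi.single i 1) = b i := fun i => by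
    simp [e, Module.Basis.equivFun_symm_apply, Pi.single_apply]
  let η : Ω → Fin n → PadicAlgCl p := fun ω i => torsPow (z ω) (e.symm (Pi.single i 1))
  have hη : ∀ ω, IsTorsionPoint p (η ω) := fun ω => (hz ω).torsPow _
  have hηz : ∀ ω a, torsPow (η ω) a = torsPow (z ω) (e.symm a) := fun ω a =>
    torsPow_linearMap (hz ω) e.symm.toLinearMap a
  let one : IsTorsionPoint p (1 : Fin n → intRing K) := isTorsionPoint_one
  let φ := substHom K one e.toLinearMap
  let ψ := substHom K one e.symm.toLinearMap
  -- The change of coordinates is invertible on power series, so `f` stays nonzero in the adapted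
  -- coordinates.
  have hψφ : ψ.comp φ = RingHom.id _ := by
    refine ringHom_eq_of_continuous ((continuous_substHom K one _).comp
      (continuous_substHom K one _)) continuous_id (fun c => ?_) fun i => ?_
    · simp [φ, ψ, substHom_C]
    · simp [φ, ψ, substHom_X, substHom_character, torsPow_one, character_single]
  have hφf : φ f ≠ 0 := fun h => hf0 (by
    have := RingHom.congr_fun hψφ f
    rw [RingHom.comp_apply, h, map_zero] at this
    exact this.symm)
  have hev := eventually_evalAt_ne_zero_of_closer hη (U := U) (fun a ha => by
      simp only [hηz]
      exact hU _ (by simpa using ha)) (fun i j hij N => by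
      simp only [hηz, he]
      exact hb i j hij N) hφf
  obtain ⟨ω, h1, h2⟩ := (hev.and hf).exists
  refine h1 ((evalAt_substHom K one e.toLinearMap (hη ω) (hz ω) (fun i => ?_) f).trans h2)
  simp [hηz, torsPow_single (hz ω)]

end Generic

/-! ### Saturated submodules and duality -/

section Saturated

variable {n : ℕ}

/-- A submodule of `ℤ_p^n` is saturated if the quotient by it has no torsion. -/
def IsSaturated (P : Submodule ℤ_[p] (Fin n → ℤ_[p])) : Prop :=
  ∀ (c : ℤ_[p]) (a : Fin n → ℤ_[p]), c ≠ 0 → c • a ∈ P → a ∈ P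

/-- A saturated submodule of `ℤ_p^n` is the kernel of a split surjection onto some `ℤ_p^d`. -/
theorem IsSaturated.exists_split {P : Submodule ℤ_[p] (Fin n → ℤ_[p])} (hP : IsSaturated P) :
    ∃ (d : ℕ) (L : (Fin n → ℤ_[p]) →ₗ[ℤ_[p]] (Fin d → ℤ_[p]))
      (s : (Fin d → ℤ_[p]) →ₗ[ℤ_[p]] (Fin n → ℤ_[p])),
      LinearMap.ker L = P ∧ ∀ b, L (s b) = b := by
  have : Module.IsTorsionFree ℤ_[p] ((Fin n → ℤ_[p]) ⧸ P) := by
    rw [Module.isTorsionFree_iff_smul_eq_zero]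
    intro c x hx
    obtain ⟨a, rfl⟩ := P.mkQ_surjective x
    rw [or_iff_not_imp_left]
    intro hc
    rw [← map_smul] at hx
    exact (Submodule.Quotient.mk_eq_zero P).2 (hP c a hc ((Submodule.Quotient.mk_eq_zero P).1 hx))
  have : Module.Free ℤ_[p] ((Fin n → ℤ_[p]) ⧸ P) := Module.free_of_finite_type_torsion_free'
  let e := (Module.finBasis ℤ_[p] ((Fin n → ℤ_[p]) ⧸ P)).equivFun
  let L := e.toLinearMap.comp P.mkQ
  have hL : LinearMap.range L = ⊤ :=
    LinearMap.range_eq_top.2 (e.surjective.comp P.mkQ_surjective)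
  obtain ⟨s, hs⟩ := LinearMap.exists_rightInverse_of_surjective L hL
  refine ⟨_, L, s, ?_, fun b => LinearMap.congr_fun hs b⟩
  rw [LinearEquiv.ker_comp, Submodule.ker_mkQ]

theorem IsSaturated.isSubtorus {P : Submodule ℤ_[p] (Fin n → ℤ_[p])} (hP : IsSaturated P) :
    IsSubtorus P := by
  obtain ⟨d, L, s, rfl, hs⟩ := hP.exists_split
  refine ⟨LinearMap.range s, ?_, ?_⟩
  · rw [Submodule.disjoint_def]
    rintro x hx ⟨y, rfl⟩
    rw [LinearMap.mem_ker, hs] at hx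
    rw [hx, map_zero]
  · rw [codisjoint_iff, eq_top_iff]
    intro x _
    rw [← sub_add_cancel x (s (L x))]
    refine Submodule.add_mem_sup ?_ ⟨_, rfl⟩
    rw [LinearMap.mem_ker, map_sub, hs, sub_self]

/-- The orthogonal complement of a group of characters in the group of cocharacters. -/
def annihilator (P : Submodule ℤ_[p] (Fin n → ℤ_[p])) : Submodule ℤ_[p] (Fin n → ℤ_[p]) where
  carrier := {t | ∀ a ∈ P, ∑ i, a i * t i = 0}
  add_mem' := fun {t t'} ht ht' a ha => by
    simp [mul_add, Finset.sum_add_distrib, ht a ha, ht' a ha]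
  zero_mem' := fun a _ => by simp
  smul_mem' := fun c t ht a ha => by
    have : ∑ i, a i * (c • t) i = c * ∑ i, a i * t i := by
      rw [Finset.mul_sum]
      exact Finset.sum_congr rfl fun i _ => by simp [mul_left_comm]
    rw [this, ht a ha, mul_zero]

theorem isSaturated_annihilator (P : Submodule ℤ_[p] (Fin n → ℤ_[p])) :
    IsSaturated (annihilator P) := by
  intro c t hc ht a ha
  have h : ∑ i, a i * (c • t) i = c * ∑ i, a i * t i := by
    rw [Finset.mul_sum]
    exact Finset.sum_congr rfl fun i _ => by simp [mul_left_comm]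
  exact (mul_eq_zero.1 (h.symm.trans (ht a ha))).resolve_left hc

theorem linearMap_apply_eq_sum {d : ℕ} (L : (Fin n → ℤ_[p]) →ₗ[ℤ_[p]] (Fin d → ℤ_[p]))
    (a : Fin n → ℤ_[p]) (j : Fin d) : L a j = ∑ i, a i * L (Pi.single i 1) j := by
  conv_lhs => rw [← Finset.univ_sum_single a, map_sum, Finset.sum_apply]
  refine Finset.sum_congr rfl fun i _ => ?_
  have h : (Pi.single i (a i) : Fin n → ℤ_[p]) = a i • Pi.single i 1 := by
    rw [← Pi.single_smul, smul_eq_mul, mul_one]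
  rw [h, map_smul, Pi.smul_apply, smul_eq_mul]

/-- The components of the split surjection with kernel `P` are cocharacters orthogonal to `P`; one
of them detects `a`. -/
theorem IsSaturated.exists_mem_annihilator {P : Submodule ℤ_[p] (Fin n → ℤ_[p])}
    (hP : IsSaturated P) {a : Fin n → ℤ_[p]} (ha : a ∉ P) :
    ∃ t ∈ annihilator P, ∑ i, a i * t i ≠ 0 := by
  obtain ⟨d, L, s, rfl, hs⟩ := hP.exists_split
  rw [LinearMap.mem_ker] at ha
  obtain ⟨j, hj⟩ := Function.ne_iff.1 ha
  refine ⟨fun i => L (Pi.single i 1) j, fun b hb => ?_, ?_⟩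
  · rw [← linearMap_apply_eq_sum, LinearMap.mem_ker.1 hb, Pi.zero_apply]
  · rwa [← linearMap_apply_eq_sum]

theorem IsSaturated.mem_iff {P : Submodule ℤ_[p] (Fin n → ℤ_[p])}
    (hP : IsSaturated P) {a : Fin n → ℤ_[p]} :
    a ∈ P ↔ ∀ t ∈ annihilator P, ∑ i, a i * t i = 0 := by
  refine ⟨fun ha t ht => ht a ha, fun h => ?_⟩
  by_contra ha
  obtain ⟨t, ht, hne⟩ := hP.exists_mem_annihilator ha
  exact hne (h t ht)

theorem IsSaturated.one_le_finrank_annihilator {P : Submodule ℤ_[p] (Fin n → ℤ_[p])}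
    (hP : IsSaturated P) (h : P ≠ ⊤) : 1 ≤ Module.finrank ℤ_[p] (annihilator P) := by
  obtain ⟨a, -, ha⟩ := SetLike.exists_of_lt (lt_top_iff_ne_top.2 h)
  obtain ⟨t, ht, hne⟩ := hP.exists_mem_annihilator ha
  have : Nontrivial (annihilator P) :=
    ⟨⟨⟨t, ht⟩, 0, fun h0 => hne (by
      have : t = 0 := congrArg Subtype.val h0
      simp [this])⟩⟩
  exact Module.finrank_pos

end Saturated

/-! ### Ideals of translates of subtori -/

section TranslateIdeal

variable {n : ℕ} {K : IntermediateField ℚ_[p] (PadicAlgCl p)} [FiniteDimensional ℚ_[p] K]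

/-- The ideal is the image of the compact space of coefficient tuples. -/
theorem isClosed_span_range {R : Type*} [CommRing R] [TopologicalSpace R] [IsTopologicalRing R]
    [CompactSpace R] [T2Space R] {ι : Type*} [Finite ι] (g : ι → R) :
    IsClosed (Ideal.span (Set.range g) : Set R) := by
  cases nonempty_fintype ι
  have h : (Ideal.span (Set.range g) : Set R) = Set.range fun c : ι → R => ∑ i, c i * g i := by
    ext x
    rw [SetLike.mem_coe, Ideal.mem_span_range_iff_exists_fun]
    rfl
  rw [h]
  refine (isCompact_range ?_).isClosed
  exact continuous_finsetSum _ fun i _ => (continuous_apply i).mul continuous_const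

/-- A continuous endomorphism over the constants that moves the variables only within an ideal
moves all power series only within this ideal. -/
theorem sub_mem_of_forall_X_sub_mem {χ : TorusRing n K →+* TorusRing n K} (hχ : Continuous χ)
    (hC : ∀ c, χ (MvPowerSeries.C c) = MvPowerSeries.C c) {J : Ideal (TorusRing n K)}
    (hX : ∀ i, MvPowerSeries.X i - χ (MvPowerSeries.X i) ∈ J) (f : TorusRing n K) :
    f - χ f ∈ J := by
  -- Replacing `J` by the ideal of these finitely many differences makes it closed, so checking
  -- polynomials suffices.
  let g : Fin n → TorusRing n K := fun i => MvPowerSeries.X i - χ (MvPowerSeries.X i)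
  have hle : Ideal.span (Set.range g) ≤ J := by
    rw [Ideal.span_le]
    rintro _ ⟨i, rfl⟩
    exact hX i
  refine hle ?_
  have hcl : IsClosed {f | f - χ f ∈ Ideal.span (Set.range g)} :=
    (isClosed_span_range g).preimage (continuous_id.sub hχ)
  refine (denseRange_toMvPowerSeries (σ := Fin n) (R := intRing K)).induction_on f hcl fun q => ?_
  have hq : (Ideal.Quotient.mk (Ideal.span (Set.range g))).comp
        (MvPolynomial.coeToMvPowerSeries.ringHom) =
      ((Ideal.Quotient.mk (Ideal.span (Set.range g))).comp χ).comp
        (MvPolynomial.coeToMvPowerSeries.ringHom) := by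
    refine MvPolynomial.ringHom_ext (fun c => ?_) fun i => ?_
    · simp [hC]
    · simp only [RingHom.comp_apply, MvPolynomial.coeToMvPowerSeries.ringHom_apply,
        MvPolynomial.coe_X]
      exact Ideal.Quotient.eq.2 (Ideal.subset_span ⟨i, rfl⟩)
  exact Ideal.Quotient.eq.1 (by simpa using RingHom.congr_fun hq q)

omit [FiniteDimensional ℚ_[p] K] in
theorem character_sub_mem_translateIdeal {P : Submodule ℤ_[p] (Fin n → ℤ_[p])}
    (ζ : Fin n → intRing K) {a : Fin n → ℤ_[p]} (ha : a ∈ P) :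
    character K a - MvPowerSeries.C (torsPow ζ a) ∈ translateIdeal K (annihilator P) ζ :=
  Ideal.subset_span ⟨a, fun _ ht => ht a ha, rfl⟩

/-- The functions that vanish on the translate of a subtorus, in terms of a parametrization of the
translate, lie in its ideal. -/
theorem mem_translateIdeal_of_substHom_eq_zero {d : ℕ}
    {L : (Fin n → ℤ_[p]) →ₗ[ℤ_[p]] (Fin d → ℤ_[p])}
    {s : (Fin d → ℤ_[p]) →ₗ[ℤ_[p]] (Fin n → ℤ_[p])} (hs : ∀ b, L (s b) = b)
    {ζ : Fin n → intRing K} (hζ : IsTorsionPoint p ζ) {f : TorusRing n K}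
    (hf : substHom K hζ L f = 0) :
    f ∈ translateIdeal K (annihilator (LinearMap.ker L)) ζ := by
  -- With this choice the composite sends a character `a` to itself with `a - s (L a)` replaced by
  -- its constant value at `ζ`: it retracts functions onto the translate.
  let ζ' : Fin d → intRing K := fun j => torsPow ζ ((-s) (Pi.single j 1))
  have hζ' : IsTorsionPoint p ζ' := hζ.torsPow _
  let ψ := substHom K hζ' s
  have hχ : Continuous (ψ.comp (substHom K hζ L)) :=
    (continuous_substHom K hζ' s).comp (continuous_substHom K hζ L)
  have key := sub_mem_of_forall_X_sub_mem hχ (fun c => by simp [ψ, substHom_C])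
    (J := translateIdeal K (annihilator (LinearMap.ker L)) ζ) (fun i => ?_) f
  · rwa [RingHom.comp_apply, hf, map_zero, sub_zero] at key
  · let v : Fin n → ℤ_[p] := Pi.single i 1
    have ha : v - s (L v) ∈ LinearMap.ker L := by
      rw [LinearMap.mem_ker, map_sub, hs, sub_self]
    have h := Ideal.mul_mem_right (character K (s (L v))) _
      (character_sub_mem_translateIdeal ζ ha)
    convert! h using 1
    have h1 : character K v = character K (v - s (L v)) * character K (s (L v)) := by
      rw [← character_add, sub_add_cancel]
    have h2 : torsPow ζ (v - s (L v)) = ζ i * torsPow ζ (-(s (L v))) := by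
      rw [sub_eq_add_neg, torsPow_add hζ, torsPow_single hζ]
    have h3 : torsPow ζ' (L v) = torsPow ζ (-(s (L v))) := torsPow_linearMap hζ (-s) (L v)
    have h4 : (MvPowerSeries.X i : TorusRing n K) = character K v - 1 := by
      rw [character_single]; ring
    rw [sub_mul, ← h1, RingHom.comp_apply, substHom_X, map_sub, map_mul, substHom_C,
      substHom_character, h3, h4, h2]
    simp only [map_mul, map_one]
    ring

end TranslateIdeal

/-! ### The vanishing ideal of an ultrafilter of torsion points -/

section Ultrafilter

variable {Ω : Type*} {n : ℕ} {z : Ω → Fin n → PadicAlgCl p}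

/-- The group of characters that have bounded order along the ultrafilter `U`. -/
def boundedCharacters (U : Ultrafilter Ω) (hz : ∀ ω, IsTorsionPoint p (z ω)) :
    Submodule ℤ_[p] (Fin n → ℤ_[p]) where
  carrier := {a | ∃ N : ℕ, ∀ᶠ ω in U, torsPow (z ω) a ^ p ^ N = 1}
  add_mem' := by
    rintro a b ⟨N, hN⟩ ⟨M, hM⟩
    refine ⟨N + M, ?_⟩
    filter_upwards [hN, hM] with ω h h'
    rw [torsPow_add (hz ω), mul_pow, pow_add, pow_mul, h, mul_comm (p ^ N), pow_mul, h']
    simp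
  zero_mem' := ⟨0, Eventually.of_forall fun ω => by simp [torsPow_zero (hz ω)]⟩
  smul_mem' := by
    rintro c a ⟨N, hN⟩
    refine ⟨N, ?_⟩
    filter_upwards [hN] with ω h
    rw [torsPow_smul (hz ω)]
    exact rootPow_pow_eq_one h c

variable (U : Ultrafilter Ω) (hz : ∀ ω, IsTorsionPoint p (z ω))

/-- Up to a unit `c` is a power of `p`, which only raises the bound on the order. -/
theorem isSaturated_boundedCharacters : IsSaturated (boundedCharacters U hz) := by
  intro c a hc hca
  have h1 : ((p ^ c.valuation : ℕ) : ℤ_[p]) • a ∈ boundedCharacters U hz := by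
    have h := Submodule.smul_mem _ ((PadicInt.unitCoeff hc)⁻¹ : ℤ_[p]ˣ).1 hca
    have hu : ((PadicInt.unitCoeff hc)⁻¹ : ℤ_[p]ˣ).1 * c = ((p ^ c.valuation : ℕ) : ℤ_[p]) := by
      rw [Units.inv_mul_eq_iff_eq_mul, Nat.cast_pow]
      exact PadicInt.unitCoeff_spec hc
    rwa [smul_smul, hu] at h
  obtain ⟨N, hN⟩ := h1
  refine ⟨c.valuation + N, ?_⟩
  filter_upwards [hN] with ω hω
  rwa [torsPow_natCast_smul (hz ω), ← pow_mul, ← pow_add] at hω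

/-- Along an ultrafilter of torsion points, the characters of bounded order are constant. -/
theorem eventually_eventually_torsPow_eq : ∀ᶠ ω₀ in U, ∀ᶠ ω in U,
    ∀ a ∈ boundedCharacters U hz, torsPow (z ω) a = torsPow (z ω₀) a := by
  obtain ⟨G, hG⟩ := (IsNoetherian.noetherian (boundedCharacters U hz) :
    (boundedCharacters U hz).FG)
  have hmem : ∀ g : G, (g : Fin n → ℤ_[p]) ∈ boundedCharacters U hz := fun g => by
    rw [← hG]; exact Submodule.subset_span g.2
  have hconst : ∀ g : G, ∃ w : PadicAlgCl p, ∀ᶠ ω in U, torsPow (z ω) (g : Fin n → ℤ_[p]) = w := by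
    intro g
    obtain ⟨N, hN⟩ := hmem g
    -- A character of bounded order takes finitely many values, so one value prevails along `U`;
    -- finitely many generators then determine all of `P`.
    have hfin : {w : PadicAlgCl p | w ^ p ^ N = 1}.Finite := by
      classical
      have hpN : 0 < p ^ N := pow_pos (Fact.out : p.Prime).pos N
      refine (Polynomial.nthRoots (p ^ N) (1 : PadicAlgCl p)).toFinset.finite_toSet.subset ?_
      intro w hw
      simpa [Polynomial.mem_nthRoots hpN] using hw
    obtain ⟨w, -, hw⟩ := (Ultrafilter.eventually_exists_mem_iff (f := U) hfin
      (P := fun w ω => torsPow (z ω) (g : Fin n → ℤ_[p]) = w)).1 (hN.mono fun ω hω => ⟨_, hω, rfl⟩)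
    exact ⟨w, hw⟩
  choose w hw using hconst
  have hall := eventually_all.2 hw
  filter_upwards [hall] with ω₀ h₀
  filter_upwards [hall] with ω h a ha
  rw [← hG] at ha
  induction ha using Submodule.span_induction with
  | mem a ha => exact (h ⟨a, ha⟩).trans (h₀ ⟨a, ha⟩).symm
  | zero => rw [torsPow_zero (hz ω), torsPow_zero (hz ω₀)]
  | add a b _ _ iha ihb => rw [torsPow_add (hz ω), torsPow_add (hz ω₀), iha, ihb]
  | smul c a _ iha => rw [torsPow_smul (hz ω), torsPow_smul (hz ω₀), iha]

variable {K : IntermediateField ℚ_[p] (PadicAlgCl p)} [FiniteDimensional ℚ_[p] K]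

omit [FiniteDimensional ℚ_[p] K] in
theorem coe_torsPow {ζ : Fin n → intRing K} (hζ : IsTorsionPoint p ζ) (a : Fin n → ℤ_[p]) :
    ((torsPow ζ a : intRing K) : PadicAlgCl p) = torsPow (fun i => (ζ i : PadicAlgCl p)) a :=
  map_torsPow ((intRing K).val : intRing K →* PadicAlgCl p) hζ a

/-- The functions vanishing along an ultrafilter of torsion points form the ideal of a translate of
a subtorus. -/
theorem eventually_evalAt_eq_zero_iff {ζ : Fin n → intRing K} (hζ : IsTorsionPoint p ζ)
    (h : ∀ᶠ ω in U, ∀ a ∈ boundedCharacters U hz,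
      torsPow (z ω) a = (torsPow ζ a : intRing K)) (f : TorusRing n K) :
    (∀ᶠ ω in U, evalAt K (hz ω) f = 0) ↔
      f ∈ translateIdeal K (annihilator (boundedCharacters U hz)) ζ := by
  have hsat := isSaturated_boundedCharacters U hz
  constructor
  · intro hf
    obtain ⟨d, L, s, hL, hs⟩ := hsat.exists_split
    rw [← hL]
    refine mem_translateIdeal_of_substHom_eq_zero hs hζ ?_
    have hζc : IsTorsionPoint p (fun i => (ζ i : PadicAlgCl p)) :=
      hζ.map ((intRing K).val : intRing K →* PadicAlgCl p)
    -- Translating by the inverse of `ζ` and restricting to the complement `s` of `P` gives points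
    -- of the quotient torus.
    let η : Ω → Fin d → PadicAlgCl p := fun ω j =>
      torsPow (z ω) (s (Pi.single j 1)) * torsPow (fun i => (ζ i : PadicAlgCl p))
        ((-s) (Pi.single j 1))
    have hη : ∀ ω, IsTorsionPoint p (η ω) := fun ω =>
      ((hz ω).torsPow _).mul (hζc.torsPow _)
    have hηpow : ∀ ω b, torsPow (η ω) b = torsPow (z ω) (s b) *
        torsPow (fun i => (ζ i : PadicAlgCl p)) (-(s b)) := by
      intro ω b
      rw [torsPow_mul ((hz ω).torsPow _) (hζc.torsPow _), torsPow_linearMap (hz ω),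
        torsPow_linearMap hζc]
      rfl
    -- A character trivial along these points would pull back to a character of bounded order in the
    -- complement of `P`.
    have hgen : IsGeneric U η := by
      intro b hb
      by_contra hev
      rw [← Ultrafilter.eventually_not] at hev
      have hsb : s b ∈ boundedCharacters U hz := by
        obtain ⟨k, hk⟩ := hζc.exists_pow
        refine ⟨k, ?_⟩
        filter_upwards [hev] with ω hω
        rw [not_not, hηpow] at hω
        have h1 : torsPow (z ω) (s b) = torsPow (fun i => (ζ i : PadicAlgCl p)) (s b) := by
          have h2 := torsPow_neg_mul hζc (s b)
          calc torsPow (z ω) (s b) = torsPow (z ω) (s b) *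
                (torsPow (fun i => (ζ i : PadicAlgCl p)) (-(s b)) *
                  torsPow (fun i => (ζ i : PadicAlgCl p)) (s b)) := by rw [h2, mul_one]
            _ = _ := by rw [← mul_assoc, hω, one_mul]
        rw [h1]
        exact torsPow_pow_eq_one hk _
      rw [← hL, LinearMap.mem_ker, hs] at hsb
      exact hb hsb
    refine eq_zero_of_eventually_evalAt_eq_zero hη hgen ?_
    filter_upwards [hf, h] with ω hω hωP
    rw [evalAt_substHom K hζ L (hη ω) (hz ω) (fun i => ?_), hω]
    let v : Fin n → ℤ_[p] := Pi.single i 1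
    have hv : v - s (L v) ∈ boundedCharacters U hz := by
      rw [← hL, LinearMap.mem_ker, map_sub, hs, sub_self]
    have h1 := hωP _ hv
    rw [coe_torsPow hζ, sub_eq_add_neg, torsPow_add hζc, torsPow_single hζc] at h1
    rw [hηpow]
    change z ω i = ζ i * (torsPow (z ω) (s (L v)) *
      torsPow (fun i => (ζ i : PadicAlgCl p)) (-(s (L v))))
    rw [mul_left_comm, ← h1, ← torsPow_add (hz ω), add_comm, neg_add_cancel_right,
      torsPow_single (hz ω)]
  · intro hf
    filter_upwards [h] with ω hω
    have hle : translateIdeal K (annihilator (boundedCharacters U hz)) ζ ≤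
        RingHom.ker (evalAt K (hz ω)) := by
      refine Ideal.span_le.2 ?_
      rintro _ ⟨a, ha, rfl⟩
      have hb : ∏ i, rootPow (ζ i) (a i) = torsPow ζ a := rfl
      rw [SetLike.mem_coe, RingHom.mem_ker, map_sub, evalAt_character, evalAt_C, hb,
        hω a (hsat.mem_iff.2 ha), sub_self]
    exact hle hf

end Ultrafilter

/-! ### Galois action, irreducibility and density -/

section Points

variable {n : ℕ} {F : IntermediateField ℚ_[p] (PadicAlgCl p)}

/-- Automorphisms preserve the spectral norm, hence are continuous and commute with convergent sums;
they fix the coefficients. -/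
theorem VanishesAt.galois {f : TorusRing n F} {ζ : Fin n → PadicAlgCl p} (h : VanishesAt f ζ)
    (σ : Gal(PadicAlgCl p/F)) : VanishesAt f (fun i => σ (ζ i)) := by
  have hnorm : ∀ x, ‖σ x‖ = ‖x‖ := fun x =>
    (spectralNorm_eq_of_equiv (σ.restrictScalars ℚ_[p]) x).symm
  have hcont : Continuous (σ : PadicAlgCl p →+* PadicAlgCl p) :=
    AddMonoidHomClass.continuous_of_bound (σ : PadicAlgCl p →+* PadicAlgCl p) 1
      fun x => by rw [one_mul]; exact (hnorm x).le
  have hmap := HasSum.map h (σ : PadicAlgCl p →+* PadicAlgCl p) hcont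
  rw [map_zero] at hmap
  refine hmap.congr_fun fun m => ?_
  have hcoeff : σ ((MvPowerSeries.coeff m f : intRing F) : PadicAlgCl p) =
      (MvPowerSeries.coeff m f : intRing F) :=
    σ.commutes ⟨_, (MvPowerSeries.coeff m f).2.2⟩
  simp [hcoeff]

theorem galois_mem_torsionPointsOn {I : Ideal (TorusRing n F)} {ζ : Fin n → PadicAlgCl p}
    (h : ζ ∈ torsionPointsOn I) (σ : Gal(PadicAlgCl p/F)) :
    (fun i => σ (ζ i)) ∈ torsionPointsOn I :=
  ⟨h.1.map (σ : PadicAlgCl p →* PadicAlgCl p), fun f hf => (h.2 f hf).galois σ⟩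

theorem mem_of_forall_galois {x : PadicAlgCl p} (h : ∀ σ : Gal(PadicAlgCl p/F), σ x = x) :
    x ∈ F := by
  obtain ⟨y, rfl⟩ := (InfiniteGalois.mem_range_algebraMap_iff_fixed (k := F) x).2 h
  exact y.2

theorem baseChange_refl (n : ℕ) : baseChange n (le_refl F) = RingHom.id (TorusRing n F) := rfl

variable [FiniteDimensional ℚ_[p] F]

omit [FiniteDimensional ℚ_[p] F] in
theorem evalAt_baseChange_of_mem {I : Ideal (TorusRing n F)}
    {K : IntermediateField ℚ_[p] (PadicAlgCl p)} [FiniteDimensional ℚ_[p] K] (hFK : F ≤ K)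
    {ζ : Fin n → PadicAlgCl p} (hζ : ζ ∈ torsionPointsOn I) {f : TorusRing n K}
    (hf : f ∈ (I.map (baseChange n hFK)).radical) : evalAt K hζ.1 f = 0 := by
  obtain ⟨k, hk⟩ := hf
  have hle : I.map (baseChange n hFK) ≤ RingHom.ker (evalAt K hζ.1) := by
    rw [Ideal.map_le_iff_le_comap]
    intro g hg
    exact (vanishesAt_iff hζ.1 _).1 ((vanishesAt_baseChange_iff hFK g ζ).2 (hζ.2 g hg))
  have h := hle hk
  rw [RingHom.mem_ker, map_pow] at h
  exact eq_zero_of_pow_eq_zero h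

theorem evalAt_of_mem_radical {I : Ideal (TorusRing n F)} {ζ : Fin n → PadicAlgCl p}
    (hζ : ζ ∈ torsionPointsOn I) {f : TorusRing n F} (hf : f ∈ I.radical) :
    evalAt F hζ.1 f = 0 := by
  refine evalAt_baseChange_of_mem (le_refl F) hζ ?_
  rwa [baseChange_refl, Ideal.map_id]

omit [FiniteDimensional ℚ_[p] F] in
theorem GeometricallyIrreducible.isPrime_radical {I : Ideal (TorusRing n F)}
    (hI : GeometricallyIrreducible I) (K : IntermediateField ℚ_[p] (PadicAlgCl p))
    [hK : FiniteDimensional ℚ_[p] K] (hFK : F ≤ K) :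
    (I.map (baseChange n hFK)).radical.IsPrime := by
  have h := PrimeSpectrum.irreducibleSpace_iff_isPrime_nilradical.1 (hI K hFK hK)
  have hc := Ideal.IsPrime.comap (hK := h) (Ideal.Quotient.mk (I.map (baseChange n hFK)))
  have he : Ideal.comap (Ideal.Quotient.mk (I.map (baseChange n hFK))) (nilradical _) =
      (I.map (baseChange n hFK)).radical := by
    rw [nilradical, Ideal.zero_eq_bot, Ideal.comap_radical, ← RingHom.ker_eq_comap_bot,
      Ideal.mk_ker]
  rwa [he] at hc

/-- If the special points are dense, then a function outside the radical does not vanish at some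
torsion point. -/
theorem exists_evalAt_ne_zero {I : Ideal (TorusRing n F)} (hd : Dense (specialPoints I))
    {f : TorusRing n F} (hf : f ∉ I.radical) :
    ∃ ζ : torsionPointsOn I, evalAt F ζ.2.1 f ≠ 0 := by
  have hne : (PrimeSpectrum.basicOpen (Ideal.Quotient.mk I f) :
      Set (PrimeSpectrum (TorusRing n F ⧸ I))).Nonempty := by
    rw [Set.nonempty_iff_ne_empty]
    intro h
    have hbot : PrimeSpectrum.basicOpen (Ideal.Quotient.mk I f) = ⊥ := by
      ext1
      simpa using h
    obtain ⟨k, hk⟩ := (PrimeSpectrum.basicOpen_eq_bot_iff _).1 hbot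
    rw [← map_pow, Ideal.Quotient.eq_zero_iff_mem] at hk
    exact hf ⟨k, hk⟩
  obtain ⟨P, hP, ζ, hζ, hPζ⟩ := hd.inter_open_nonempty _ PrimeSpectrum.isOpen_basicOpen hne
  have hmem : ζ ∈ torsionPointsOn I := by
    refine ⟨hζ, fun g hg => (hPζ g).1 ?_⟩
    rw [Ideal.Quotient.eq_zero_iff_mem.2 hg]
    exact Submodule.zero_mem _
  refine ⟨⟨ζ, hmem⟩, fun h0 => hP ?_⟩
  exact (hPζ f).2 ((vanishesAt_iff hmem.1 f).2 h0)

/-- If the radical of `I` is prime and the special points are dense, then there is an ultrafilter of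
torsion points along which exactly the functions in the radical vanish. -/
theorem exists_ultrafilter_radical {I : Ideal (TorusRing n F)} (hprime : I.radical.IsPrime)
    (hd : Dense (specialPoints I)) : ∃ U : Ultrafilter (torsionPointsOn I),
      ∀ f : TorusRing n F, (∀ᶠ ζ : torsionPointsOn I in U, evalAt F ζ.2.1 f = 0) ↔ f ∈ I.radical := by
  -- These nonvanishing loci are nonempty by density and directed because the radical is prime, so
  -- some ultrafilter contains them all.
  let A : {f : TorusRing n F // f ∉ I.radical} → Set (torsionPointsOn I) :=
    fun f => {ζ | evalAt F ζ.2.1 f.1 ≠ 0}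
  have hA : ∀ f, (A f).Nonempty := fun f => exists_evalAt_ne_zero hd f.2
  have h1 : (1 : TorusRing n F) ∉ I.radical :=
    fun h => hprime.ne_top ((Ideal.eq_top_iff_one _).2 h)
  have : Nonempty {f : TorusRing n F // f ∉ I.radical} := ⟨⟨1, h1⟩⟩
  have : Nonempty (torsionPointsOn I) := ⟨(hA ⟨1, h1⟩).choose⟩
  have hdir : Directed (· ≥ ·) fun f => 𝓟 (A f) := by
    intro f g
    refine ⟨⟨f.1 * g.1, fun h => (hprime.mem_or_mem h).elim f.2 g.2⟩, ?_, ?_⟩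
    · refine principal_mono.2 fun ζ (hζ : _ ≠ _) h => hζ ?_
      rw [map_mul, h, zero_mul]
    · refine principal_mono.2 fun ζ (hζ : _ ≠ _) h => hζ ?_
      rw [map_mul, h, mul_zero]
  have : (⨅ f, 𝓟 (A f)).NeBot :=
    iInf_neBot_of_directed hdir fun f => principal_neBot_iff.2 (hA f)
  refine ⟨Ultrafilter.of (⨅ f, 𝓟 (A f)), fun f => ⟨fun h => ?_, fun h => ?_⟩⟩
  · by_contra hf
    have hle := (Ultrafilter.of_le (⨅ f, 𝓟 (A f))).trans (iInf_le _ ⟨f, hf⟩)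
    have hne : ∀ᶠ ζ in (Ultrafilter.of (⨅ f, 𝓟 (A f)) : Filter (torsionPointsOn I)),
        evalAt F ζ.2.1 f ≠ 0 := hle (mem_principal_self _)
    obtain ⟨ζ, h1, h2⟩ := (hne.and h).exists
    exact h1 h2
  · exact Eventually.of_forall fun ζ => evalAt_of_mem_radical ζ.2 h

/-- Geometric irreducibility forces a character that is a root of unity on the reduced subscheme to
be constant. -/
theorem GeometricallyIrreducible.exists_forall_torsPow_eq {I : Ideal (TorusRing n F)}
    (hI : GeometricallyIrreducible I) {a : Fin n → ℤ_[p]} {N : ℕ}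
    (ha : character F a ^ p ^ N - 1 ∈ I.radical) :
    ∃ w : PadicAlgCl p, ∀ ζ ∈ torsionPointsOn I, torsPow ζ a = w := by
  have hpos : 0 < p ^ N := pow_pos (Fact.out : p.Prime).pos N
  have : NeZero (p ^ N) := ⟨hpos.ne'⟩
  have : NeZero ((p ^ N : ℕ) : PadicAlgCl p) := ⟨by exact_mod_cast hpos.ne'⟩
  obtain ⟨ε, hε⟩ := HasEnoughRootsOfUnity.exists_primitiveRoot (PadicAlgCl p) (p ^ N)
  obtain ⟨K, hFK, hK, hεK⟩ := exists_finite_extension F (fun _ : Fin 1 => ε)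
  obtain ⟨δ, -, hδ⟩ := exists_lift_intRing (ζ := fun _ : Fin 1 => ε)
    (fun _ => ⟨N, hε.pow_eq_one⟩) hεK
  have hδ : (δ 0 : PadicAlgCl p) = ε := hδ 0
  have hprim : IsPrimitiveRoot (δ 0) (p ^ N) := by
    rw [← hδ] at hε
    exact IsPrimitiveRoot.of_map_of_injective (f := (intRing K).val) hε Subtype.val_injective
  have hprimC : IsPrimitiveRoot (MvPowerSeries.C (δ 0) : TorusRing n K) (p ^ N) :=
    hprim.map_of_injective (f := (MvPowerSeries.C : intRing K →+* TorusRing n K))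
      (MvPowerSeries.C_injective)
  have : IsDomain (TorusRing n K) := NoZeroDivisors.to_isDomain _
  have hrad := hI.isPrime_radical K hFK
  have hmem : character K a ^ p ^ N - 1 ^ p ^ N ∈ (I.map (baseChange n hFK)).radical := by
    have := Ideal.map_radical_le (baseChange n hFK) (Ideal.mem_map_of_mem _ ha)
    rwa [map_sub, map_pow, map_one, baseChange_character, ← one_pow (p ^ N)] at this
  -- Over a field with the `p ^ N`-th roots of unity the equation splits into linear factors, and
  -- primality of the radical selects one.
  rw [hprimC.pow_sub_pow_eq_prod_sub_mul _ _ hpos, hrad.prod_mem_iff] at hmem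
  obtain ⟨ξ, hξ, hmem⟩ := hmem
  rw [Polynomial.mem_nthRootsFinset hpos] at hξ
  obtain ⟨i, -, rfl⟩ := hprimC.eq_pow_of_pow_eq_one hξ
  refine ⟨(δ 0 ^ i : intRing K), fun ζ hζ => ?_⟩
  have h := evalAt_baseChange_of_mem hFK hζ hmem
  rwa [mul_one, ← map_pow, map_sub, evalAt_character, evalAt_C, sub_eq_zero] at h

end Points

end FormalTorus

end

/-! ### The two assertions -/

open FormalTorus Filter in
theorem corollary2p17 (p : ℕ) [Fact p.Prime] (F : IntermediateField ℚ_[p] (PadicAlgCl p))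
    [FiniteDimensional ℚ_[p] F] (n : ℕ) (I : Ideal (FormalTorus.TorusRing n F)) :
    ((FormalTorus.torsionPointsOn I).Infinite →
      ∃ (K : IntermediateField ℚ_[p] (PadicAlgCl p)) (hFK : F ≤ K),
        FiniteDimensional ℚ_[p] K ∧
        ∃ (T : Submodule ℤ_[p] (Fin n → ℤ_[p])) (ζ : Fin n → FormalTorus.intRing K),
          FormalTorus.IsSubtorus T ∧ 1 ≤ Module.finrank ℤ_[p] T ∧
          FormalTorus.IsTorsionPoint p ζ ∧
          I.map (FormalTorus.baseChange n hFK) ≤ FormalTorus.translateIdeal K T ζ) ∧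
    (FormalTorus.GeometricallyIrreducible I → Dense (FormalTorus.specialPoints I) →
      ∃ (T : Submodule ℤ_[p] (Fin n → ℤ_[p])) (ζ : Fin n → FormalTorus.intRing F),
        FormalTorus.IsSubtorus T ∧ FormalTorus.IsTorsionPoint p ζ ∧
        I.radical = FormalTorus.translateIdeal F T ζ ∧
        (IsReduced (FormalTorus.TorusRing n F ⧸ I) →
          I = FormalTorus.translateIdeal F T ζ)) := by
  have hz : ∀ ζ : torsionPointsOn I, IsTorsionPoint p (ζ : Fin n → PadicAlgCl p) := fun ζ => ζ.2.1
  constructor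
  · intro hinf
    have : Infinite (torsionPointsOn I) := hinf.to_subtype
    let U := hyperfilter (torsionPointsOn I)
    let P := boundedCharacters U hz
    have hP : IsSaturated P := isSaturated_boundedCharacters U hz
    obtain ⟨ζ₀, hζ₀⟩ := (eventually_eventually_torsPow_eq U hz).exists
    obtain ⟨K, hFK, hK, hζK⟩ := exists_finite_extension F ζ₀.1
    obtain ⟨ζ, hζ, hζζ₀⟩ := exists_lift_intRing (hz ζ₀) hζK
    refine ⟨K, hFK, hK, annihilator P, ζ, (isSaturated_annihilator P).isSubtorus,
      hP.one_le_finrank_annihilator fun htop => ?_, hζ, ?_⟩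
    · have hev : ∀ᶠ ξ in U, ξ ∈ ({ζ₀} : Set (torsionPointsOn I)) := by
        filter_upwards [hζ₀] with ξ hξ
        refine Subtype.ext (funext fun i => ?_)
        have := hξ (Pi.single i 1) (by change _ ∈ P; rw [htop]; trivial)
        rwa [torsPow_single (hz ξ), torsPow_single (hz ζ₀)] at this
      exact notMem_hyperfilter_of_finite (Set.finite_singleton ζ₀) hev
    · rw [Ideal.map_le_iff_le_comap]
      intro f hf
      refine (eventually_evalAt_eq_zero_iff U hz hζ ?_ _).1 (Eventually.of_forall fun ξ =>
        evalAt_baseChange_of_mem hFK ξ.2 (Ideal.le_radical (Ideal.mem_map_of_mem _ hf)))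
      filter_upwards [hζ₀] with ξ hξ a ha
      rw [hξ a ha, coe_torsPow hζ]
      simp only [hζζ₀]
  · intro hI hd
    have hprime : I.radical.IsPrime := by
      have := hI.isPrime_radical F le_rfl
      rwa [baseChange_refl, Ideal.map_id] at this
    obtain ⟨U, hU⟩ := exists_ultrafilter_radical hprime hd
    let P := boundedCharacters U hz
    have hP : IsSaturated P := isSaturated_boundedCharacters U hz
    obtain ⟨ζ₀, hζ₀⟩ := (eventually_eventually_torsPow_eq U hz).exists
    -- The value is the same at all torsion points on the subscheme, in particular at the Galois
    -- conjugates of `ζ₀`, so it is Galois invariant.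
    have hF : ∀ a ∈ P, torsPow (ζ₀ : Fin n → PadicAlgCl p) a ∈ F := by
      intro a ha
      obtain ⟨N, hN⟩ := ha
      obtain ⟨w, hw⟩ := hI.exists_forall_torsPow_eq (a := a) (N := N) (by
        rw [← hU]
        filter_upwards [hN] with ξ hξ
        rw [map_sub, map_pow, map_one, evalAt_character, hξ, sub_self])
      refine mem_of_forall_galois fun σ => ?_
      have h1 := map_torsPow (σ : PadicAlgCl p →* PadicAlgCl p) (hz ζ₀) a
      exact h1.trans ((hw _ (galois_mem_torsionPointsOn ζ₀.2 σ)).trans (hw _ ζ₀.2).symm)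
    obtain ⟨d, L, s, hL, hs⟩ := hP.exists_split
    -- The point `ζ₀` need not be defined over `F`, but its values on `P` are. Precomposing with the
    -- projection `π` onto `P` gives a point over `F` with the same values on `P`, hence the same
    -- translate.
    let π : (Fin n → ℤ_[p]) →ₗ[ℤ_[p]] (Fin n → ℤ_[p]) := LinearMap.id - s.comp L
    have hπ : ∀ a, π a ∈ P := fun a => by
      rw [← hL, LinearMap.mem_ker]
      simp [π, hs]
    have hπP : ∀ a ∈ P, π a = a := fun a ha => by
      rw [← hL, LinearMap.mem_ker] at ha
      simp [π, ha]
    obtain ⟨ζ, hζ, hζζ₀⟩ := exists_lift_intRing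
      ((hz ζ₀).torsPow fun i : Fin n => π (Pi.single i 1)) fun i => hF _ (hπ _)
    have hrad : I.radical = translateIdeal F (annihilator P) ζ := by
      ext f
      rw [← hU]
      refine eventually_evalAt_eq_zero_iff U hz hζ ?_ f
      filter_upwards [hζ₀] with ξ hξ a ha
      rw [hξ a ha, coe_torsPow hζ]
      simp only [hζζ₀]
      rw [torsPow_linearMap (hz ζ₀) π a, hπP a ha]
    refine ⟨annihilator P, ζ, (isSaturated_annihilator P).isSubtorus, hζ, hrad, fun hred => ?_⟩
    rw [← hrad, ((Ideal.isRadical_iff_quotient_reduced I).2 hred).radical]
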